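/- Fix $d\ge 1$. Let $A=(A_x)_{x\in\mathbb R^d}$ be a jointly measurable real random field with $E[A_x^2]<\infty$ for all $x$, whose sample paths are almost surely locally integrable, and which is centered and weakly stationary: $E[A_x]=0$ and $\mathrm{Cov}(A_x,A_y)=K(x-y)$ for all $x,y\in\mathbb R^d$, with $K:\mathbb R^d\to\mathbb R$ measurable. Let $\mathcal D$ be a class of subsets of $\mathbb R^d$ such that one of the following holds. - **Case 1.** $K$ is radial, i.e. $K(z)=k(|z|)$ for some function $k$, and $\mathcal D$ is the class of all compact sets $D\subseteq\mathbb R^d$ of finite perimeter, $\mathrm{Per}(D)=\sup\{\int_D \operatorname{div}\varphi\,dx:\varphi\in C_c^1(\mathbb R^d,\mathbb R^d),\ |\varphi|\le 1\}<\infty$. - **Case 2.** For some $x_0\in\mathbb R^d$, $\mathcal D$ is the class of all closed balls $\{x:|x-x_0|\le r\}$, $r\ge 0$. Put $w_t=\int_{\{|z|\le t\}}K(z)\,dz$ and assume that $w$ is regularly varying with index $\alpha\in(-1,d]$: $w_t=\ell(t)\,t^\alpha$ for all $t>0$, where $\ell:(0,\infty)\to\mathbb R$ is slowly varying, that is, $\ell$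 is measurable, positive on $[a,\infty)$ for some $a>0$, and $\ell(ts)/\ell(t)\to1$ as $t\to\infty$ for every $s>0$. For $D,L\in\mathcal D$ let $g_{D,L}(z)=\mathrm{Vol}(D\cap(L+z))$ be the cross covariogram. Let $d\theta$ be the surface measure on the unit sphere $S^{d-1}$ and $\omega_{d-1}=\int_{S^{d-1}}d\theta$ (for $d=1$, $d\theta$ is the counting measure on $\{-1,1\}$ and $\omega_0=2$). Then for all $D,L\in\mathcal D$: the random variables $\int_{tD}A_x\,dx$ and $\int_{tL}A_x\,dx$ are square integrable for every $t>0$; for every $\theta\in S^{d-1}$ the derivative $\frac{d}{dl}g_{D,L}(l\theta)$ exists for almost every $l>0$, and $l\mapsto\frac{d}{dl}g_{D,L}(l\theta)$ and $l\mapsto\bigl(-\frac{d}{dl}g_{D,L}(l\theta)\bigr)l^\alpha$ are integrable on $(0,\infty)$; the function $\theta\mapsto\int_0^\infty\bigl(-\frac{d}{dl}g_{D,L}(l\theta)\bigr)l^\alpha\,dl$ is integrable on $S^{d-1}$; and, as $t\to\infty$, $$\mathrm{Cov}\left(\frac{\int_{tD}A_x\,dx}{t^{d/2}w_t^{1/2}},\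 \frac{\int_{tL}A_x\,dx}{t^{d/2}w_t^{1/2}}\right)\longrightarrow\frac1{\omega_{d-1}}\int_{S^{d-1}}\int_0^\infty\left(-\frac{d}{dl}g_{D,L}(l\theta)\right)l^{\alpha}\,dl\,d\theta .$$ -/

import Mathlib

open MeasureTheory ProbabilityTheory Set Filter Topology
open scoped Pointwise ENNReal

noncomputable section

/-- Euclidean space of dimension `d`. -/
abbrev Eucl (d : ℕ) : Type := EuclideanSpace ℝ (Fin d)

/-- `A = (A_x)` is a (jointly measurable) random field on `ℝ^d` which is locally integrable,
square integrable at each point, centered and weakly stationary with measurable covariance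
function `K`, i.e. `E[A_x] = 0` and `Cov(A_x, A_y) = K (x - y)`.
Joint measurability is only asked up to null sets. -/
structure IsWeaklyStationaryField {d : ℕ} {Ω : Type*} [MeasurableSpace Ω] (P : Measure Ω)
    (A : Eucl d → Ω → ℝ) (K : Eucl d → ℝ) : Prop where
  jointly_measurable :
    AEStronglyMeasurable (fun p : Eucl d × Ω => A p.1 p.2) ((volume : Measure (Eucl d)).prod P)
  locallyIntegrable : ∀ᵐ ω ∂P, LocallyIntegrable (fun x => A x ω) volume
  memLp_two : ∀ x, MemLp (A x) 2 P
  centered : ∀ x, ∫ ω, A x ω ∂P = 0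
  covariance_eq : ∀ x y, cov[A x, A y; P] = K (x - y)
  measurable_cov : Measurable K

/-- `w_t = ∫_{|z| ≤ t} K(z) dz`. -/
def ballIntegral {d : ℕ} (K : Eucl d → ℝ) (t : ℝ) : ℝ :=
  ∫ z in {z : Eucl d | ‖z‖ ≤ t}, K z

/-- A function on `(0, ∞)` is slowly varying: it is measurable, positive on some `[a, ∞)`, and
`ℓ (t s) / ℓ t → 1` as `t → ∞` for all `s > 0`. Values at `t ≤ 0` play no role. -/
def SlowlyVarying (ℓ : ℝ → ℝ) : Prop :=
  Measurable (fun t : Ioi (0 : ℝ) => ℓ t) ∧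
  (∃ a > 0, ∀ t ≥ a, 0 < ℓ t) ∧
  ∀ s > 0, Tendsto (fun t => ℓ (t * s) / ℓ t) atTop (𝓝 1)

/-- `h` is regularly varying with index `α`: `h t = ℓ(t) t^α` with `ℓ` slowly varying. -/
def RegularlyVarying (h : ℝ → ℝ) (α : ℝ) : Prop :=
  ∃ ℓ : ℝ → ℝ, SlowlyVarying ℓ ∧ ∀ t > 0, h t = ℓ t * t ^ α

/-- The divergence of a vector field on `ℝ^d`. -/
def divergence {d : ℕ} (φ : Eucl d → Eucl d) (x : Eucl d) : ℝ :=
  ∑ i, (fderiv ℝ φ x (EuclideanSpace.single i 1)) i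

/-- The perimeter of a set, in the generalized sense: the total variation of its indicator,
`sup { ∫_D div φ : φ ∈ C_c^1(ℝ^d, ℝ^d), |φ| ≤ 1 }`. (The supremum is nonnegative, as is seen
from `φ = 0`, so that truncating negative values does not change it.) -/
def perimeter {d : ℕ} (D : Set (Eucl d)) : ℝ≥0∞ :=
  ⨆ (φ : Eucl d → Eucl d) (_ : ContDiff ℝ 1 φ) (_ : HasCompactSupport φ)
    (_ : ∀ x, ‖φ x‖ ≤ 1), ENNReal.ofReal (∫ x in D, divergence φ x)

/-- The class of compact sets of finite perimeter. -/
def compactFinitePerimeter (d : ℕ) : Set (Set (Eucl d)) :=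
  {D | IsCompact D ∧ perimeter D < ⊤}

/-- The class of closed balls centered at `x₀`. -/
def concentricBalls {d : ℕ} (x₀ : Eucl d) : Set (Set (Eucl d)) :=
  {D | ∃ r : ℝ, 0 ≤ r ∧ D = {x | ‖x - x₀‖ ≤ r}}

/-- `K` is radial. -/
def IsRadial {d : ℕ} (K : Eucl d → ℝ) : Prop :=
  ∃ k : ℝ → ℝ, ∀ z, K z = k ‖z‖

/-- The cross covariogram `g_{D,L}(z) = Vol(D ∩ (L + z))`. -/
def crossCovariogram {d : ℕ} (D L : Set (Eucl d)) (z : Eucl d) : ℝ :=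
  volume.real (D ∩ ((fun y => y + z) '' L))

/-- The surface measure `dθ` on the unit sphere `S^{d-1}` (counting measure on two points
if `d = 1`). -/
def surfaceMeasure (d : ℕ) : Measure (Metric.sphere (0 : Eucl d) 1) :=
  (volume : Measure (Eucl d)).toSphere

/-- `ω_{d-1}`, the surface area of `S^{d-1}`. -/
def sphereArea (d : ℕ) : ℝ := (surfaceMeasure d).real univ

/-- The directional derivative `d/dl g_{D,L}(l θ)`. -/
def radialDeriv {d : ℕ} (D L : Set (Eucl d)) (θ : Eucl d) (l : ℝ) : ℝ :=
  deriv (fun s : ℝ => crossCovariogram D L (s • θ)) l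

/-- The inner integral `∫_0^∞ (-d/dl g_{D,L}(l θ)) l^α dl`. -/
def radialIntegral {d : ℕ} (D L : Set (Eucl d)) (α : ℝ) (θ : Eucl d) : ℝ :=
  ∫ l in Ioi (0 : ℝ), (-radialDeriv D L θ l) * l ^ α

/-- The normalized integral `(∫_{tD} A_x dx) / (t^{d/2} w_t^{1/2})`. -/
def normalizedIntegral {d : ℕ} {Ω : Type*} (A : Eucl d → Ω → ℝ) (K : Eucl d → ℝ)
    (D : Set (Eucl d)) (t : ℝ) (ω : Ω) : ℝ :=
  (∫ x in t • D, A x ω) / (t ^ ((d : ℝ) / 2) * (ballIntegral K t) ^ ((1 : ℝ) / 2))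

end

/-! By Fubini and the substitution `z = x - y`, the covariance of the two integrals is `t ^ d * ∫
K(z) g(z / t) dz`, where `g` is the cross covariogram. It remains to divide this last integral by
`w_t`. The function `g` is Lipschitz and vanishes far out, so along each ray it is the integral of
minus its derivative. This layer cake formula (`integral_mul_comp_eq_integral_deriv`) trades `K` for
its integrals over balls: the integral becomes the spherical mean of `∫ -∂_l g(lθ) w_{tl} dl`. If
`K` is radial, the formula is applied on each ray with the radial part of Lebesgue measure; if `g`
is radial, it is applied once on the whole space with `ρ z = ‖z / t‖`. After division by `w_t`,
regular variation gives `w_{tl} / w_t → l ^ α` pointwise. Potter bounds supply a majorant `c * l ^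
(α - ε)`, integrable at `0` for small `ε` because `α > -1`. They fail where `tl` is bounded; there
the trivial bound `|w_s| ≤ const * s ^ d` takes over, which is where `α ≤ d` enters
(`RegularlyVarying.exists_bound`). The geometric input is the Lipschitz bound: by duality with test
fields for sets of finite perimeter, by a shell volume estimate for balls. -/

/-! ### Regular variation: uniform convergence, Potter bounds, domination. -/

/-- Uniform convergence theorem for additive slow variation, on the unit interval. -/
theorem exists_forall_abs_add_sub_lt {h : ℝ → ℝ} (hm : Measurable h)
    (hlim : ∀ u, Tendsto (fun x => h (x + u) - h x) atTop (𝓝 0)) {ε : ℝ} (hε : 0 < ε) :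
    ∃ T, ∀ x ≥ T, ∀ v ∈ Icc (0 : ℝ) 1, |h (x + v) - h x| < ε := by
  let S : ℝ → Set ℝ := fun x => {u | |h (x + u) - h x| < ε / 2}
  have hS : ∀ x, MeasurableSet (S x) := fun x =>
    measurableSet_lt (((hm.comp (measurable_const_add x)).sub_const _).abs) measurable_const
  -- Dominated convergence: the good shifts `S x` eventually fill almost all of `[0, 2]`.
  have hvol : Tendsto (fun x => ∫ u in Icc (0 : ℝ) 2, (S x).indicator (fun _ => (1 : ℝ)) u) atTop
      (𝓝 (∫ u in Icc (0 : ℝ) 2, (1 : ℝ))) := by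
    refine tendsto_integral_filter_of_dominated_convergence (fun _ => 1) ?_ ?_ ?_ ?_
    · exact Eventually.of_forall fun x =>
        (measurable_const.indicator (hS x)).aestronglyMeasurable
    · refine Eventually.of_forall fun x => Eventually.of_forall fun u => ?_
      by_cases hu : u ∈ S x <;> simp [hu]
    · simp
    · refine Eventually.of_forall fun u => ?_
      refine tendsto_const_nhds.congr' ?_
      have := (hlim u).abs.eventually_lt_const (u := ε / 2) (by simpa using by positivity)
      filter_upwards [this] with x hx
      rw [indicator_of_mem (show u ∈ S x from hx)]
  have hvol' : ∀ x, ∫ u in Icc (0 : ℝ) 2, (S x).indicator (fun _ => (1 : ℝ)) u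
      = volume.real (S x ∩ Icc 0 2) := by
    intro x
    rw [integral_indicator (hS x), Measure.restrict_restrict (hS x)]
    simp
  simp only [hvol'] at hvol
  have h2 : ∫ u in Icc (0 : ℝ) 2, (1 : ℝ) = 2 := by simp
  rw [h2] at hvol
  obtain ⟨T, hT⟩ := eventually_atTop.1 (hvol.eventually_const_lt (u := 3 / 2) (by norm_num))
  refine ⟨T, fun x hx v hv => ?_⟩
  have hfin : ∀ y, volume (S y ∩ Icc 0 2) ≠ ∞ := fun y =>
    ((measure_mono inter_subset_right).trans_lt (by simp : volume (Icc (0:ℝ) 2) < ∞)).ne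
  let B : Set ℝ := (fun u => u - v) ⁻¹' (S (x + v) ∩ Icc 0 2)
  have hBm : MeasurableSet B := ((hS _).inter measurableSet_Icc).preimage (measurable_sub_const v)
  have hBv : volume B = volume (S (x + v) ∩ Icc 0 2) :=
    (measurePreserving_sub_right (volume : Measure ℝ) v).measure_preimage
      ((hS (x + v)).inter measurableSet_Icc).nullMeasurableSet
  have hB : volume.real B = volume.real (S (x + v) ∩ Icc 0 2) := by
    rw [measureReal_def, measureReal_def, hBv]
  have hBfin : volume B ≠ ∞ := hBv ▸ hfin _
  -- Both sets have measure above `3 / 2` inside `[0, 3]`, so they meet. A common shift `u` puts `h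
  -- (x + u)` within `ε / 2` of both `h x` and `h (x + v)`.
  have hne : ((S x ∩ Icc 0 2) ∩ B).Nonempty := by
    by_contra hcon
    have hdisj : Disjoint (S x ∩ Icc 0 2) B := by
      rw [disjoint_iff_inter_eq_empty]; exact not_nonempty_iff_eq_empty.1 hcon
    have hu := measureReal_union hdisj hBm (hfin x) hBfin
    have hsub : (S x ∩ Icc 0 2) ∪ B ⊆ Icc 0 3 := by
      rintro u (⟨_, hu⟩ | ⟨_, hu⟩)
      · exact ⟨hu.1, by linarith [hu.2]⟩
      · exact ⟨by linarith [hu.1, hv.1], by linarith [hu.2, hv.2]⟩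
    have hle : volume.real ((S x ∩ Icc 0 2) ∪ B) ≤ volume.real (Icc (0 : ℝ) 3) :=
      measureReal_mono hsub (by simp)
    have h3 : volume.real (Icc (0 : ℝ) 3) = 3 := by simp
    have e1 := hT x hx
    have e2 := hT (x + v) (by linarith [hv.1])
    linarith
  obtain ⟨u, ⟨hu1, _⟩, hu2, _⟩ := hne
  have hu1' : |h (x + u) - h x| < ε / 2 := hu1
  have hu2' : |h (x + v + (u - v)) - h (x + v)| < ε / 2 := hu2
  rw [show x + v + (u - v) = x + u by ring] at hu2'
  rw [abs_lt] at *
  constructor <;> linarith [hu1'.1, hu1'.2, hu2'.1, hu2'.2]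

/-- Chaining: `y` is reached from `x` in at most `|y - x| + 1` steps of length at most one, each
costing at most `ε`. -/
theorem exists_forall_abs_sub_le_mul {h : ℝ → ℝ} (hm : Measurable h)
    (hlim : ∀ u, Tendsto (fun x => h (x + u) - h x) atTop (𝓝 0)) {ε : ℝ} (hε : 0 < ε) :
    ∃ T, ∀ x ≥ T, ∀ y ≥ T, |h y - h x| ≤ ε * (|y - x| + 1) := by
  obtain ⟨T, hT⟩ := exists_forall_abs_add_sub_lt hm hlim hε
  have key : ∀ n : ℕ, ∀ x ≥ T, ∀ v ∈ Icc (0 : ℝ) 1, |h (x + n + v) - h x| ≤ ε * (n + 1) := by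
    intro n
    induction n with
    | zero => intro x hx v hv; simpa using (hT x hx v hv).le
    | succ n ih =>
      intro x hx v hv
      have e1 := ih (x + 1) (by linarith) v hv
      have e2 := hT x hx 1 (by simp)
      have : x + ((n + 1 : ℕ) : ℝ) + v = x + 1 + n + v := by push_cast; ring
      rw [this]
      have := abs_sub_le (h (x + 1 + n + v)) (h (x + 1)) (h x)
      push_cast
      linarith
  have main : ∀ x ≥ T, ∀ y ≥ x, |h y - h x| ≤ ε * (|y - x| + 1) := by
    intro x hx y hy
    have hf := Nat.floor_le (sub_nonneg.2 hy)
    have e := key ⌊y - x⌋₊ x hx (y - x - ⌊y - x⌋₊)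
      ⟨by linarith, by linarith [Nat.lt_floor_add_one (y - x)]⟩
    rw [show x + (⌊y - x⌋₊ : ℝ) + (y - x - ⌊y - x⌋₊) = y by ring] at e
    rw [abs_of_nonneg (sub_nonneg.2 hy)]
    exact e.trans (by gcongr)
  refine ⟨T, fun x hx y hy => ?_⟩
  rcases le_total x y with hxy | hxy
  · exact main x hx y hxy
  · rw [abs_sub_comm, abs_sub_comm y x]; exact main y hy x hxy

/-- Potter bounds. -/
theorem SlowlyVarying.exists_potter {ℓ : ℝ → ℝ} (hℓ : SlowlyVarying ℓ) {ε : ℝ} (hε : 0 < ε) :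
    ∃ T > 0, ∀ t ≥ T, 0 < ℓ t ∧ ∀ s ≥ T,
      ℓ s ≤ Real.exp (ε * (|Real.log s - Real.log t| + 1)) * ℓ t := by
  obtain ⟨hm, ⟨a, ha, hpos⟩, hlim⟩ := hℓ
  -- Passing to `log ∘ ℓ ∘ exp` makes slow variation additive. Since `ℓ` is measurable only on `(0,
  -- ∞)`, `exp` is taken with values in that subtype.
  have hm' : Measurable (fun x => Real.log (ℓ (Real.exp x))) := by
    have : Measurable (fun x : ℝ => (⟨Real.exp x, Real.exp_pos x⟩ : Ioi (0 : ℝ))) :=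
      Real.measurable_exp.subtype_mk
    exact Real.measurable_log.comp (hm.comp this)
  have hlim' : ∀ u, Tendsto (fun x => Real.log (ℓ (Real.exp (x + u))) - Real.log (ℓ (Real.exp x)))
      atTop (𝓝 0) := by
    intro u
    have h1 := (hlim (Real.exp u) (Real.exp_pos u)).comp Real.tendsto_exp_atTop
    have h2 := ((Real.continuousAt_log one_ne_zero).tendsto).comp h1
    rw [Real.log_one] at h2
    refine h2.congr' ?_
    filter_upwards [Real.tendsto_exp_atTop.eventually_ge_atTop a,
      (tendsto_atTop_add_const_right _ u tendsto_id).eventually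
        (Real.tendsto_exp_atTop.eventually_ge_atTop a)] with x hx1 hx2
    simp only [Function.comp, id] at *
    rw [← Real.exp_add, Real.log_div (hpos _ hx2).ne' (hpos _ hx1).ne']
  obtain ⟨T, hT⟩ := exists_forall_abs_sub_le_mul hm' hlim' hε
  refine ⟨max a (Real.exp T), lt_max_of_lt_left ha, fun t ht => ⟨hpos t (le_of_max_le_left ht),
    fun s hs => ?_⟩⟩
  have ht0 : 0 < t := ha.trans_le (le_of_max_le_left ht)
  have hs0 : 0 < s := ha.trans_le (le_of_max_le_left hs)
  have hℓt := hpos t (le_of_max_le_left ht)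
  have hℓs := hpos s (le_of_max_le_left hs)
  have e := hT (Real.log t) ((Real.le_log_iff_exp_le ht0).2 (le_of_max_le_right ht))
    (Real.log s) ((Real.le_log_iff_exp_le hs0).2 (le_of_max_le_right hs))
  simp only [Real.exp_log ht0, Real.exp_log hs0] at e
  calc ℓ s = Real.exp (Real.log (ℓ s) - Real.log (ℓ t)) * ℓ t := by
        rw [Real.exp_sub, Real.exp_log hℓs, Real.exp_log hℓt]; field_simp
    _ ≤ _ := by
        gcongr
        exact (le_abs_self _).trans e

/-- Potter bounds handle `t * l ≥ T`. For `t * l < T` the a priori bound is split as `(t * l) ^ (δ -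
α + ε) * (t * l) ^ (α - ε)`: the first factor is at most a power of `T` because `δ ≥ α`, and `t ^ (α
- ε)` is absorbed by `W t`. -/
theorem RegularlyVarying.exists_bound {W : ℝ → ℝ} {α : ℝ} (hW : RegularlyVarying W α)
    {B δ : ℝ} (hδ : α ≤ δ) (hB : ∀ t > 0, |W t| ≤ B * t ^ δ) {ε : ℝ} (hε : 0 < ε) {M : ℝ} :
    ∃ C T : ℝ, 0 < T ∧ ∀ t ≥ T, 0 < W t ∧
      ∀ l, 0 < l → l ≤ M → |W (t * l)| ≤ C * l ^ (α - ε) * W t := by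
  obtain ⟨ℓ, hℓ, hWℓ⟩ := hW
  obtain ⟨T, hT0, hT⟩ := hℓ.exists_potter hε
  have hB0 : 0 ≤ B := by simpa using (abs_nonneg _).trans (hB 1 one_pos)
  have hℓT := (hT T le_rfl).1
  let N : ℝ := max M 1
  have hN1 : 1 ≤ N := le_max_right _ _
  let C₁ : ℝ := Real.exp ε * N ^ (2 * ε)
  let C₂ : ℝ := B * T ^ (δ - α + ε) * (Real.exp ε * T ^ (-ε) / ℓ T)
  have hC₁ : 0 ≤ C₁ := by positivity
  have hC₂ : 0 ≤ C₂ := by positivity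
  refine ⟨C₁ + C₂, T, hT0, fun t ht => ?_⟩
  have ht0 : 0 < t := hT0.trans_le ht
  have hℓt := (hT t ht).1
  have hWt : 0 < W t := by rw [hWℓ t ht0]; positivity
  refine ⟨hWt, fun l hl hlM => ?_⟩
  have htl : 0 < t * l := mul_pos ht0 hl
  have hlp : 0 < l ^ (α - ε) := Real.rpow_pos_of_pos hl _
  rcases le_or_gt T (t * l) with hcase | hcase
  · have e := (hT t ht).2 (t * l) hcase
    have hℓtl := (hT _ hcase).1
    have hlog : Real.log (t * l) - Real.log t = Real.log l := by
      rw [Real.log_mul ht0.ne' hl.ne']; ring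
    rw [hlog] at e
    -- As `l ≤ N` with `N ≥ 1`, `|log l| ≤ 2 log N - log l`; the two-sided Potter factor thus
    -- reduces to the single power `l ^ (-ε)`.
    have hexp : Real.exp (ε * (|Real.log l| + 1)) ≤ C₁ * l ^ (-ε) := by
      have hNp : N ^ (2 * ε) = Real.exp (Real.log N * (2 * ε)) :=
        Real.rpow_def_of_pos (by linarith) _
      rw [Real.rpow_def_of_pos hl]
      simp only [C₁]
      rw [hNp, ← Real.exp_add, ← Real.exp_add, Real.exp_le_exp]
      have hlN : Real.log l ≤ Real.log N := Real.log_le_log hl (hlM.trans (le_max_left _ _))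
      have hN0 : 0 ≤ Real.log N := Real.log_nonneg hN1
      have : |Real.log l| ≤ 2 * Real.log N - Real.log l := abs_le.2 ⟨by linarith, by linarith⟩
      nlinarith
    rw [hWℓ _ htl, abs_of_pos (by positivity), hWℓ t ht0, Real.mul_rpow ht0.le hl.le]
    calc ℓ (t * l) * (t ^ α * l ^ α) ≤ (C₁ * l ^ (-ε) * ℓ t) * (t ^ α * l ^ α) := by
          gcongr; exact e.trans (by gcongr)
      _ = C₁ * l ^ (α - ε) * (ℓ t * t ^ α) := by
          rw [sub_eq_add_neg, Real.rpow_add hl]; ring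
      _ ≤ _ := by gcongr; linarith
  -- Potter between `T` and `t` bounds `ℓ t` below by a multiple of `t ^ (-ε)`, so `W t` dominates
  -- `t ^ (α - ε)`.
  · have e := (hT t ht).2 T le_rfl
    have hlt : |Real.log T - Real.log t| = Real.log t - Real.log T := by
      rw [abs_sub_comm, abs_of_nonneg (sub_nonneg.2 (Real.log_le_log hT0 ht))]
    have hexp : Real.exp (ε * (|Real.log T - Real.log t| + 1))
        = Real.exp ε * T ^ (-ε) * t ^ ε := by
      rw [hlt, Real.rpow_def_of_pos hT0, Real.rpow_def_of_pos ht0, ← Real.exp_add, ← Real.exp_add]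
      congr 1; ring
    rw [hexp] at e
    have e2 : t ^ (α - ε) ≤ (Real.exp ε * T ^ (-ε) / ℓ T) * W t := by
      rw [hWℓ t ht0, div_mul_eq_mul_div, le_div_iff₀ hℓT]
      have : t ^ α = t ^ (α - ε) * t ^ ε := by rw [← Real.rpow_add ht0]; congr 1; ring
      rw [this]
      calc t ^ (α - ε) * ℓ T ≤ t ^ (α - ε) * (Real.exp ε * T ^ (-ε) * t ^ ε * ℓ t) := by gcongr
        _ = _ := by ring
    calc |W (t * l)| ≤ B * (t * l) ^ δ := hB _ htl
      _ = B * ((t * l) ^ (δ - α + ε) * (t * l) ^ (α - ε)) := by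
          rw [← Real.rpow_add htl]; congr 2; ring
      _ ≤ B * (T ^ (δ - α + ε) * (t * l) ^ (α - ε)) := by
          gcongr
      _ = B * T ^ (δ - α + ε) * t ^ (α - ε) * l ^ (α - ε) := by
          rw [Real.mul_rpow ht0.le hl.le]; ring
      _ ≤ B * T ^ (δ - α + ε) * ((Real.exp ε * T ^ (-ε) / ℓ T) * W t) * l ^ (α - ε) := by gcongr
      _ = C₂ * l ^ (α - ε) * W t := by simp only [C₂]; ring
      _ ≤ _ := by gcongr; linarith

theorem RegularlyVarying.tendsto_div {W : ℝ → ℝ} {α : ℝ} (hW : RegularlyVarying W α)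
    {l : ℝ} (hl : 0 < l) : Tendsto (fun t => W (t * l) / W t) atTop (𝓝 (l ^ α)) := by
  obtain ⟨ℓ, hℓ, hWℓ⟩ := hW
  have := (hℓ.2.2 l hl).mul_const (l ^ α)
  rw [one_mul] at this
  refine this.congr' ?_
  filter_upwards [eventually_gt_atTop 0] with t ht
  rw [hWℓ t ht, hWℓ _ (mul_pos ht hl), Real.mul_rpow ht.le hl.le]
  have : t ^ α ≠ 0 := (Real.rpow_pos_of_pos ht _).ne'
  field_simp

/-! ### Integration by parts against a Lipschitz profile vanishing beyond `R`. -/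

section LayerCake

variable {γ : ℝ → ℝ} {C : NNReal} {R : ℝ}

theorem deriv_eq_zero_of_forall_ge_eq_zero (h0 : ∀ r ≥ R, γ r = 0) {l : ℝ} (hl : R < l) :
    deriv γ l = 0 := by
  have : γ =ᶠ[𝓝 l] fun _ => 0 := by
    filter_upwards [eventually_gt_nhds hl] with r hr using h0 r hr.le
  rw [this.deriv_eq]; simp

/-- A bounded compactly supported majorant of the derivative. -/
theorem abs_deriv_le_indicator (hγ : LipschitzWith C γ) (h0 : ∀ r ≥ R, γ r = 0) (l : ℝ) :
    |deriv γ l| ≤ (Iic R).indicator (fun _ => (C : ℝ)) l := by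
  by_cases hl : l ≤ R
  · rw [indicator_of_mem (show l ∈ Iic R from hl)]
    exact norm_deriv_le_of_lipschitz hγ
  · rw [deriv_eq_zero_of_forall_ge_eq_zero h0 (not_le.1 hl)]
    simp [hl]

theorem integrable_indicator_Iic_restrict_Ioi (c : ℝ) :
    Integrable ((Iic R).indicator (fun _ => c)) (volume.restrict (Ioi 0)) := by
  rw [integrable_indicator_iff measurableSet_Iic, IntegrableOn,
    Measure.restrict_restrict measurableSet_Iic, Iic_inter_Ioi]
  exact integrable_const _

theorem integrableOn_deriv_of_lipschitzWith (hγ : LipschitzWith C γ) (h0 : ∀ r ≥ R, γ r = 0) :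
    IntegrableOn (deriv γ) (Ioi 0) :=
  (integrable_indicator_Iic_restrict_Ioi (C : ℝ)).mono'
    (measurable_deriv γ).aestronglyMeasurable
    (Eventually.of_forall fun l => abs_deriv_le_indicator hγ h0 l)

theorem integral_Ioi_neg_deriv_of_lipschitzWith (hγ : LipschitzWith C γ)
    (h0 : ∀ r ≥ R, γ r = 0) (r : ℝ) : ∫ l in Ioi r, -deriv γ l = γ r := by
  -- Lipschitz functions are absolutely continuous, so the fundamental theorem applies. The endpoint
  -- `max r R` also covers `r > R`.
  have h1 : ∫ l in r..max r R, deriv γ l = γ (max r R) - γ r :=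
    (hγ.lipschitzOnWith (s := uIcc r (max r R))).absolutelyContinuousOnInterval.integral_deriv_eq_sub
  rw [h0 _ (le_max_right _ _), intervalIntegral.integral_of_le (le_max_left _ _)] at h1
  rw [integral_neg, setIntegral_eq_of_subset_of_forall_sdiff_eq_zero measurableSet_Ioi
    Ioc_subset_Ioi_self, h1]
  · ring
  · intro l hl
    refine deriv_eq_zero_of_forall_ge_eq_zero h0 ?_
    have : ¬ l ≤ max r R := fun h => hl.2 ⟨hl.1, h⟩
    exact (le_max_right _ _).trans_lt (not_le.1 this)

/-- Integration by parts, in the form of a layer cake formula. -/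
theorem integral_mul_comp_eq_integral_deriv {Z : Type*} [MeasurableSpace Z] {ν : Measure Z}
    [SFinite ν] {ρ : Z → ℝ} (hρ : Measurable ρ) (hρ0 : ∀ z, 0 ≤ ρ z) {k : Z → ℝ}
    (hk : IntegrableOn k {z | ρ z ≤ R} ν)
    (hγ : LipschitzWith C γ) (h0 : ∀ r ≥ R, γ r = 0) :
    ∫ z, k z * γ (ρ z) ∂ν = ∫ l in Ioi (0 : ℝ), -deriv γ l * ∫ z in {z | ρ z ≤ l}, k z ∂ν := by
  have hset : ∀ l, MeasurableSet {z | ρ z ≤ l} := fun l => measurableSet_le hρ measurable_const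
  -- `k` is integrable only on this sublevel set; truncating is harmless, since `γ (ρ z)` vanishes
  -- outside it.
  let k₁ : Z → ℝ := {z | ρ z ≤ R}.indicator k
  have hk₁ : Integrable k₁ ν := (integrable_indicator_iff (hset R)).2 hk
  -- Integrating `F` in `l` first gives the left side, in `z` first the right side.
  let F : Z → ℝ → ℝ := fun z l => {p : Z × ℝ | ρ p.1 ≤ p.2}.indicator
    (fun p => k₁ p.1 * -deriv γ p.2) (z, l)
  have hFset : MeasurableSet {p : Z × ℝ | ρ p.1 ≤ p.2} :=
    measurableSet_le (hρ.comp measurable_fst) measurable_snd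
  have hF : Integrable (Function.uncurry F) (ν.prod (volume.restrict (Ioi 0))) :=
    (hk₁.mul_prod (integrableOn_deriv_of_lipschitzWith hγ h0).neg).indicator hFset
  have hleft : ∀ z, ∫ l in Ioi (0 : ℝ), F z l = k z * γ (ρ z) := by
    intro z
    by_cases hz : ρ z ≤ R
    · have e : ∀ l, F z l = k z * (Ici (ρ z)).indicator (fun l => -deriv γ l) l := by
        intro l
        by_cases hl : ρ z ≤ l <;> simp [F, k₁, indicator, hz, hl]
      simp only [e]
      rw [integral_const_mul, setIntegral_indicator measurableSet_Ici]
      have : (Ioi 0 ∩ Ici (ρ z) : Set ℝ) =ᵐ[volume] Ioi (ρ z) := by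
        have h1 : (Ioi 0 ∩ Ici (ρ z) : Set ℝ) =ᵐ[volume] (Ioi 0 ∩ Ioi (ρ z) : Set ℝ) :=
          (ae_eq_refl _).inter Ioi_ae_eq_Ici.symm
        rwa [Ioi_inter_Ioi, sup_eq_right.2 (hρ0 z)] at h1
      rw [setIntegral_congr_set this, integral_Ioi_neg_deriv_of_lipschitzWith hγ h0]
    · have e : ∀ l, F z l = 0 := by
        intro l
        simp [F, k₁, indicator, hz]
      simp [e, h0 _ (not_le.1 hz).le]
  have hright : ∀ l, ∫ z, F z l ∂ν = -deriv γ l * ∫ z in {z | ρ z ≤ l}, k z ∂ν := by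
    intro l
    by_cases hl : l ≤ R
    · have e : ∀ z, F z l = -deriv γ l * {z | ρ z ≤ l}.indicator k z := by
        intro z
        by_cases hz : ρ z ≤ l
        · simp [F, k₁, indicator, hz, hz.trans hl, mul_comm]
        · simp [F, indicator, hz]
      simp only [e]
      rw [integral_const_mul, integral_indicator (hset l)]
    · simp [F, indicator, deriv_eq_zero_of_forall_ge_eq_zero h0 (not_le.1 hl)]
  calc ∫ z, k z * γ (ρ z) ∂ν = ∫ z, (∫ l in Ioi (0 : ℝ), F z l) ∂ν := by simp only [hleft]
    _ = ∫ l in Ioi (0 : ℝ), (∫ z, F z l ∂ν) := integral_integral_swap hF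
    _ = _ := by simp only [hright]

theorem integrable_indicator_Iic_rpow {β : ℝ} (hβ : -1 < β) (c : ℝ) :
    Integrable ((Iic R).indicator (fun l => c * l ^ β)) (volume.restrict (Ioi 0)) := by
  rw [integrable_indicator_iff measurableSet_Iic, IntegrableOn,
    Measure.restrict_restrict measurableSet_Iic, Iic_inter_Ioi]
  rcases le_or_gt 0 R with hR | hR
  · have := (intervalIntegral.intervalIntegrable_rpow' hβ (a := 0) (b := R)).1
    exact this.const_mul c
  · simp [Ioc_eq_empty_of_le hR.le]

theorem abs_neg_deriv_mul_le_indicator (hγ : LipschitzWith C γ) (h0 : ∀ r ≥ R, γ r = 0)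
    {l x b : ℝ} (hx : l ≤ R → |x| ≤ b) :
    |-deriv γ l * x| ≤ (Iic R).indicator (fun _ => (C : ℝ) * b) l := by
  have e := abs_deriv_le_indicator hγ h0 l
  rw [abs_mul, abs_neg]
  by_cases hl : l ≤ R
  · simp only [indicator, mem_Iic, hl, if_true] at e ⊢
    have := hx hl
    gcongr
  · simp only [indicator, mem_Iic, hl, if_false] at e ⊢
    have : |deriv γ l| = 0 := le_antisymm e (abs_nonneg _)
    simp [this]

theorem integrableOn_neg_deriv_mul_rpow (hγ : LipschitzWith C γ) (h0 : ∀ r ≥ R, γ r = 0)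
    {α : ℝ} (hα : -1 < α) : IntegrableOn (fun l => -deriv γ l * l ^ α) (Ioi 0) := by
  refine (integrable_indicator_Iic_rpow (R := R) hα (C : ℝ)).mono'
    ((measurable_deriv γ).neg.mul (measurable_id.pow_const α)).aestronglyMeasurable ?_
  filter_upwards [ae_restrict_mem measurableSet_Ioi] with l (hl : 0 < l)
  exact abs_neg_deriv_mul_le_indicator hγ h0
    fun _ => (abs_of_pos (Real.rpow_pos_of_pos hl α)).le

theorem abs_integral_neg_deriv_mul_le (hγ : LipschitzWith C γ) (h0 : ∀ r ≥ R, γ r = 0)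
    {W : ℝ → ℝ} {c β : ℝ} (hβ : -1 < β)
    (hW : ∀ l, 0 < l → l ≤ R → |W l| ≤ c * l ^ β) :
    |∫ l in Ioi (0 : ℝ), -deriv γ l * W l| ≤
      ∫ l in Ioi (0 : ℝ), (Iic R).indicator (fun l => (C * c) * l ^ β) l := by
  refine norm_integral_le_of_norm_le (f := fun l => -deriv γ l * W l)
    (integrable_indicator_Iic_rpow hβ _) ?_
  filter_upwards [ae_restrict_mem measurableSet_Ioi] with l (hl : 0 < l)
  refine (abs_neg_deriv_mul_le_indicator hγ h0 (hW l hl)).trans_eq ?_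
  by_cases hlR : l ≤ R <;> simp [indicator, hlR, mul_assoc]

theorem tendsto_integral_neg_deriv_mul (hγ : LipschitzWith C γ) (h0 : ∀ r ≥ R, γ r = 0)
    {W : ℝ → ℝ} (hWm : Measurable W) {α : ℝ} (hW : RegularlyVarying W α)
    {c β T : ℝ} (hβ : -1 < β)
    (hbd : ∀ t ≥ T, ∀ l, 0 < l → l ≤ R → |W (t * l) / W t| ≤ c * l ^ β) :
    Tendsto (fun t => ∫ l in Ioi (0 : ℝ), -deriv γ l * (W (t * l) / W t)) atTop
      (𝓝 (∫ l in Ioi (0 : ℝ), -deriv γ l * l ^ α)) := by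
  refine tendsto_integral_filter_of_dominated_convergence _ ?_ ?_
    (integrable_indicator_Iic_rpow (R := R) hβ (C * c)) ?_
  · refine Eventually.of_forall fun t => Measurable.aestronglyMeasurable ?_
    exact (measurable_deriv γ).neg.mul ((hWm.comp (measurable_const_mul t)).div_const _)
  · filter_upwards [eventually_ge_atTop T] with t ht
    filter_upwards [ae_restrict_mem measurableSet_Ioi] with l (hl : 0 < l)
    refine (abs_neg_deriv_mul_le_indicator hγ h0 (hbd t ht l hl)).trans_eq ?_
    by_cases hlR : l ≤ R <;> simp [indicator, hlR, mul_assoc]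
  · filter_upwards [ae_restrict_mem measurableSet_Ioi] with l (hl : 0 < l)
    exact (hW.tendsto_div hl).const_mul _

end LayerCake

/-! ### Cross covariograms: Lipschitz bounds, support, symmetry for balls. -/

section Covariogram

variable {d : ℕ} {D L : Set (Eucl d)}

theorem image_add_right_eq_preimage (L : Set (Eucl d)) (z : Eucl d) :
    (fun y => y + z) '' L = (fun x => x - z) ⁻¹' L := by
  ext x
  constructor
  · rintro ⟨y, hy, rfl⟩; simpa using hy
  · intro hx; exact ⟨x - z, hx, by simp⟩

/-- Puts the translation on the indicator of `D`, which can then be smoothed while `L` stays the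
fixed domain to which the perimeter bound applies. -/
theorem crossCovariogram_eq_setIntegral (hD : IsCompact D) (L : Set (Eucl d)) (z : Eucl d) :
    crossCovariogram D L z = ∫ y in L, D.indicator (fun _ => (1 : ℝ)) (y + z) := by
  have hDm : MeasurableSet ((fun y => y + z) ⁻¹' D) := hD.measurableSet.preimage
    (measurable_add_const z)
  have : (fun y => D.indicator (fun _ => (1 : ℝ)) (y + z))
      = ((fun y => y + z) ⁻¹' D).indicator (fun _ => (1 : ℝ)) := rfl
  rw [this, integral_indicator hDm, setIntegral_const, smul_eq_mul, mul_one,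
    measureReal_restrict_apply hDm, crossCovariogram, measureReal_def, measureReal_def,
    ← measure_preimage_add_right volume z, preimage_inter, image_add_right_eq_preimage]
  simp [← preimage_comp, Function.comp_def]

/-- A test function for the perimeter pointing in a fixed direction. -/
theorem setIntegral_fderiv_le_perimeter (hL : perimeter L < ⊤) {f : Eucl d → ℝ}
    (hf : ContDiff ℝ 1 f) (hfc : HasCompactSupport f) (hf1 : ∀ x, |f x| ≤ 1) (h : Eucl d) :
    ∫ y in L, fderiv ℝ f y h ≤ (perimeter L).toReal * ‖h‖ := by
  rcases eq_or_ne h 0 with rfl | hh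
  · simp
  have hn : 0 < ‖h‖ := norm_pos_iff.2 hh
  let u : Eucl d := ‖h‖⁻¹ • h
  have hu : ‖u‖ = 1 := by simp [u, norm_smul, hn.ne']
  have hdiv : ∀ y, divergence (fun x => f x • u) y = ‖h‖⁻¹ * fderiv ℝ f y h := by
    intro y
    have hd : DifferentiableAt ℝ f y := hf.differentiable one_ne_zero y
    have hfd : fderiv ℝ (fun x => f x • u) y = (fderiv ℝ f y).smulRight u :=
      (hd.hasFDerivAt.smul_const u).fderiv
    have hsum : h = ∑ i, h i • EuclideanSpace.single i (1 : ℝ) := by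
      ext j
      simp [Finset.sum_apply, Pi.single_apply]
    have hfh : fderiv ℝ f y h = ∑ i, h i * fderiv ℝ f y (EuclideanSpace.single i 1) := by
      conv_lhs => rw [hsum]
      simp only [map_sum, map_smul, smul_eq_mul]
    rw [hfh]
    simp only [divergence, hfd, ContinuousLinearMap.smulRight_apply, PiLp.smul_apply, smul_eq_mul,
      Finset.mul_sum, u]
    exact Finset.sum_congr rfl fun i _ => by ring
  have hle : ENNReal.ofReal (∫ x in L, divergence (fun x => f x • u) x) ≤ perimeter L := by
    unfold perimeter
    refine le_iSup_of_le (fun x => f x • u) (le_iSup_of_le (hf.smul contDiff_const)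
      (le_iSup_of_le hfc.smul_right (le_iSup_of_le (fun x => ?_) le_rfl)))
    rw [norm_smul, hu, mul_one]; exact hf1 x
  have hle' := (ENNReal.ofReal_le_iff_le_toReal hL.ne).1 hle
  simp only [hdiv] at hle'
  rw [integral_const_mul, inv_mul_le_iff₀ hn] at hle'
  linarith

/-- The increment is the integral of the derivative along the segment; after Fubini, each slice is
the perimeter bound for a translate of `f`. -/
theorem setIntegral_sub_le_perimeter (hLc : IsCompact L) (hL : perimeter L < ⊤) {f : Eucl d → ℝ}
    (hf : ContDiff ℝ 1 f) (hfc : HasCompactSupport f) (hf1 : ∀ x, |f x| ≤ 1) (h : Eucl d) :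
    ∫ y in L, (f (y + h) - f y) ≤ (perimeter L).toReal * ‖h‖ := by
  have hcont : Continuous (fderiv ℝ f) := hf.continuous_fderiv one_ne_zero
  obtain ⟨B, hB⟩ := (hfc.fderiv (𝕜 := ℝ)).exists_bound_of_continuous hcont
  have hFin : Fact (volume L < ∞) := ⟨hLc.measure_lt_top⟩
  have hder : ∀ y, ∫ s in (0 : ℝ)..1, fderiv ℝ f (y + s • h) h = f (y + h) - f y := by
    intro y
    have e : ∀ s ∈ uIcc (0 : ℝ) 1,
        HasDerivAt (fun s : ℝ => f (y + s • h)) (fderiv ℝ f (y + s • h) h) s := by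
      intro s _
      have h1 : HasDerivAt (fun s : ℝ => y + s • h) h s := by
        simpa using ((hasDerivAt_id s).smul_const h).const_add y
      exact (hf.differentiable one_ne_zero (y + s • h)).hasFDerivAt.comp_hasDerivAt s h1
    rw [intervalIntegral.integral_eq_sub_of_hasDerivAt e]
    · simp
    · exact Continuous.intervalIntegrable (by fun_prop) _ _
  have hint : Integrable (Function.uncurry fun (y : Eucl d) (s : ℝ) => fderiv ℝ f (y + s • h) h)
      ((volume.restrict L).prod (volume.restrict (Ioc 0 1))) := by
    refine Integrable.of_bound (C := B * ‖h‖) ?_ (Eventually.of_forall fun p => ?_)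
    · exact Continuous.aestronglyMeasurable (by fun_prop)
    · exact (ContinuousLinearMap.le_opNorm _ _).trans (by gcongr; exact hB _)
  calc ∫ y in L, (f (y + h) - f y)
      = ∫ y in L, (∫ s in Ioc (0 : ℝ) 1, fderiv ℝ f (y + s • h) h) := by
        simp only [← hder, intervalIntegral.integral_of_le zero_le_one]
    _ = ∫ s in Ioc (0 : ℝ) 1, (∫ y in L, fderiv ℝ f (y + s • h) h) :=
        integral_integral_swap hint
    _ ≤ ∫ s in Ioc (0 : ℝ) 1, (perimeter L).toReal * ‖h‖ := by
        refine integral_mono hint.integral_prod_right (integrable_const _) fun s => ?_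
        have e := setIntegral_fderiv_le_perimeter hL (f := fun x => f (x + s • h))
          (hf.comp (contDiff_id.add contDiff_const))
          (hfc.comp_homeomorph (Homeomorph.addRight (s • h))) (fun x => hf1 _) h
        simpa only [fderiv_comp_add_right] using e
    _ = _ := by simp

/-- A smooth Urysohn function, equal to `1` on `D` and `0` off a bounded open neighbourhood `V`,
errs only on `V \ D`, which outer regularity makes small. -/
theorem exists_contDiff_integral_abs_indicator_sub_le (hD : IsCompact D) {ε : ℝ} (hε : 0 < ε) :
    ∃ f : Eucl d → ℝ, ContDiff ℝ 1 f ∧ HasCompactSupport f ∧ (∀ x, |f x| ≤ 1) ∧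
      ∫ x, |D.indicator (fun _ => (1 : ℝ)) x - f x| ≤ ε := by
  obtain ⟨U, hDU, hU, hUlt⟩ := hD.exists_isOpen_lt_add (μ := (volume : Measure (Eucl d)))
    (ε := ENNReal.ofReal ε) (by simpa using hε)
  obtain ⟨R, hR⟩ := hD.isBounded.subset_ball (0 : Eucl d)
  let V := U ∩ Metric.ball (0 : Eucl d) R
  have hV : IsOpen V := hU.inter Metric.isOpen_ball
  have hDV : D ⊆ V := subset_inter hDU hR
  obtain ⟨f, hf, hfr, hf0, hf1⟩ := exists_contMDiff_zero_iff_one_iff_of_isClosed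
    (modelWithCornersSelf ℝ (Eucl d)) (n := 1) (s := Vᶜ) (t := D) hV.isClosed_compl hD.isClosed
    (disjoint_compl_left_iff_subset.2 hDV)
  have hf01 : ∀ x, f x ∈ Icc (0 : ℝ) 1 := fun x => hfr (mem_range_self x)
  have hfsupp : ∀ x, x ∉ V → f x = 0 := fun x hx => (hf0 x).1 hx
  refine ⟨f, hf.contDiff, ?_, fun x => ?_, ?_⟩
  · refine HasCompactSupport.of_support_subset_isCompact (isCompact_closedBall (0 : Eucl d) R) ?_
    intro x hx
    by_contra hxR
    refine hx (hfsupp x fun hxV => hxR (Metric.ball_subset_closedBall hxV.2))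
  · exact abs_le.2 ⟨by linarith [(hf01 x).1], (hf01 x).2⟩
  · have hVD : MeasurableSet (V \ D) := hV.measurableSet.diff hD.measurableSet
    have hVfin : volume V ≠ ∞ :=
      ((measure_mono inter_subset_right).trans_lt measure_ball_lt_top).ne
    have hpt : ∀ x, |D.indicator (fun _ => (1 : ℝ)) x - f x| ≤
        (V \ D).indicator (fun _ => (1 : ℝ)) x := by
      intro x
      by_cases hxD : x ∈ D
      · have : f x = 1 := (hf1 x).1 hxD
        simp [hxD, this]
      · by_cases hxV : x ∈ V
        · simp [hxD, hxV, abs_of_nonneg (hf01 x).1, (hf01 x).2]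
        · simp [hxD, hxV, hfsupp x hxV]
    have hfin : volume (V \ D) ≠ ∞ := ((measure_mono sdiff_subset).trans_lt hVfin.lt_top).ne
    calc ∫ x, |D.indicator (fun _ => (1 : ℝ)) x - f x|
        ≤ ∫ x, (V \ D).indicator (fun _ => (1 : ℝ)) x :=
          integral_mono_of_nonneg (Eventually.of_forall fun _ => abs_nonneg _)
            ((integrable_indicator_iff hVD).2 (integrableOn_const hfin))
            (Eventually.of_forall hpt)
      _ = volume.real (V \ D) := by rw [integral_indicator hVD]; simp
      _ = volume.real V - volume.real D := measureReal_sdiff hDV hD.measurableSet hVfin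
      _ ≤ ε := by
        have h1 : volume.real V ≤ volume.real U :=
          measureReal_mono inter_subset_left hUlt.ne_top
        have h2 : volume.real U ≤ volume.real D + ε := by
          have := ENNReal.toReal_mono (by simp [hD.measure_lt_top.ne]) hUlt.le
          rwa [ENNReal.toReal_add hD.measure_lt_top.ne (by simp),
            ENNReal.toReal_ofReal hε.le] at this
        linarith

/-- An `L¹` approximation of the indicator of `D` approximates `g` uniformly in the shift, so the
smooth increment estimate passes to the limit `ε → 0`. -/
theorem lipschitzWith_crossCovariogram_of_perimeter_lt_top (hD : IsCompact D) (hLc : IsCompact L)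
    (hL : perimeter L < ⊤) : LipschitzWith (perimeter L).toNNReal (crossCovariogram D L) := by
  refine LipschitzWith.of_le_add_mul _ fun x z => le_of_forall_pos_le_add fun ε hε => ?_
  obtain ⟨f, hf, hfc, hf1, hfD⟩ := exists_contDiff_integral_abs_indicator_sub_le hD
    (half_pos hε)
  have hDint : Integrable (D.indicator (fun _ => (1 : ℝ))) volume :=
    (integrable_indicator_iff hD.measurableSet).2 (integrableOn_const hD.measure_lt_top.ne)
  have hfint : Integrable f volume := hf.continuous.integrable_of_hasCompactSupport hfc
  have hsub : Integrable (fun y => D.indicator (fun _ => (1 : ℝ)) y - f y) volume :=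
    hDint.sub hfint
  have happrox : ∀ v, |crossCovariogram D L v - ∫ y in L, f (y + v)| ≤ ε / 2 := by
    intro v
    rw [crossCovariogram_eq_setIntegral hD, ← integral_sub
      (hDint.comp_add_right v).integrableOn (hfint.comp_add_right v).integrableOn]
    calc |∫ y in L, (D.indicator (fun _ => (1 : ℝ)) (y + v) - f (y + v))|
        ≤ ∫ y in L, |D.indicator (fun _ => (1 : ℝ)) (y + v) - f (y + v)| :=
          abs_integral_le_integral_abs
      _ ≤ ∫ y, |D.indicator (fun _ => (1 : ℝ)) (y + v) - f (y + v)| :=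
          setIntegral_le_integral (hsub.comp_add_right v).abs
            (Eventually.of_forall fun _ => abs_nonneg _)
      _ = ∫ y, |D.indicator (fun _ => (1 : ℝ)) y - f y| :=
          integral_add_right_eq_self (fun y => |D.indicator (fun _ => (1 : ℝ)) y - f y|) v
      _ ≤ ε / 2 := hfD
  have e := setIntegral_sub_le_perimeter hLc hL (f := fun y => f (y + z))
    (hf.comp (contDiff_id.add contDiff_const))
    (hfc.comp_homeomorph (Homeomorph.addRight z)) (fun x => hf1 _) (x - z)
  have hxz : ∀ y, y + (x - z) + z = y + x := fun y => by abel
  simp only [hxz] at e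
  rw [integral_sub (hfint.comp_add_right x).integrableOn
    (hfint.comp_add_right z).integrableOn] at e
  have e1 := abs_le.1 (happrox x)
  have e2 := abs_le.1 (happrox z)
  rw [dist_eq_norm, ENNReal.coe_toNNReal_eq_toReal]
  linarith

/-- Shifting the ball by `s ≤ 1` adds at most the shell between radii `r` and `r + s`; for `s > 1`
the volume of the ball is already a sufficient bound. -/
theorem lipschitzWith_crossCovariogram_closedBall (hD : IsCompact D) (x₀ : Eucl d) {r : ℝ}
    (hr : 0 ≤ r) : ∃ C, LipschitzWith C (crossCovariogram D (Metric.closedBall x₀ r)) := by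
  let κ : ℝ := volume.real (Metric.ball (0 : Eucl d) 1)
  have hκ : 0 ≤ κ := measureReal_nonneg
  have hball : ∀ (c : Eucl d) (s : ℝ), 0 ≤ s → volume.real (Metric.closedBall c s) = κ * s ^ d := by
    intro c s hs
    rw [measureReal_def, Measure.addHaar_closedBall _ _ hs, ENNReal.toReal_mul,
      ENNReal.toReal_ofReal (by positivity), mul_comm]
    simp [κ, measureReal_def]
  have himage : ∀ v, (fun y => y + v) '' Metric.closedBall x₀ r = Metric.closedBall (x₀ + v) r := by
    intro v
    rw [image_add_right_eq_preimage]
    ext x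
    simp [dist_eq_norm, sub_sub, add_comm]
  refine ⟨⟨κ * (r + 1) ^ d, by positivity⟩, LipschitzWith.of_le_add_mul _ fun x z => ?_⟩
  change _ ≤ _ + κ * (r + 1) ^ d * dist x z
  simp only [crossCovariogram, himage]
  set s := dist x z
  have hs : 0 ≤ s := dist_nonneg
  rcases le_or_gt s 1 with hs1 | hs1
  · have hsub : D ∩ Metric.closedBall (x₀ + x) r ⊆ (D ∩ Metric.closedBall (x₀ + z) r) ∪
        (Metric.closedBall (x₀ + z) (r + s) \ Metric.closedBall (x₀ + z) r) := by
      rintro y ⟨hyD, hy⟩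
      by_cases hyz : y ∈ Metric.closedBall (x₀ + z) r
      · exact Or.inl ⟨hyD, hyz⟩
      · refine Or.inr ⟨?_, hyz⟩
        rw [Metric.mem_closedBall] at *
        have := dist_triangle y (x₀ + x) (x₀ + z)
        rw [dist_add_left] at this
        linarith
    have hfin : volume ((D ∩ Metric.closedBall (x₀ + z) r) ∪
        (Metric.closedBall (x₀ + z) (r + s) \ Metric.closedBall (x₀ + z) r)) ≠ ∞ := by
      refine ((measure_union_le _ _).trans_lt (ENNReal.add_lt_top.2 ⟨?_, ?_⟩)).ne
      · exact (measure_mono inter_subset_left).trans_lt hD.measure_lt_top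
      · exact (measure_mono sdiff_subset).trans_lt measure_closedBall_lt_top
    have h1 := (measureReal_mono hsub hfin).trans (measureReal_union_le _ _)
    have h2 : volume.real (Metric.closedBall (x₀ + z) (r + s) \ Metric.closedBall (x₀ + z) r)
        = κ * (r + s) ^ d - κ * r ^ d := by
      rw [measureReal_sdiff (Metric.closedBall_subset_closedBall (by linarith))
        measurableSet_closedBall measure_closedBall_lt_top.ne, hball _ _ (by positivity),
        hball _ _ hr]
    -- Convexity of the power on `[r, r + 1]` makes the shell volume linear in `s`.
    have h3 : (r + s) ^ d ≤ (1 - s) * r ^ d + s * (r + 1) ^ d := by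
      have := (convexOn_pow (𝕜 := ℝ) d).2 (show r ∈ Ici 0 from hr)
        (show r + 1 ∈ Ici 0 from by simp; linarith) (sub_nonneg.2 hs1) hs (by ring)
      simp only [smul_eq_mul] at this
      rwa [show (1 - s) * r + s * (r + 1) = r + s by ring] at this
    have h4 : 0 ≤ κ * (s * r ^ d) := by positivity
    have h5 := mul_le_mul_of_nonneg_left h3 hκ
    linarith
  · have h1 : volume.real (D ∩ Metric.closedBall (x₀ + x) r) ≤ κ * r ^ d := by
      rw [← hball (x₀ + x) r hr]
      exact measureReal_mono inter_subset_right measure_closedBall_lt_top.ne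
    have h2 : κ * r ^ d ≤ κ * (r + 1) ^ d := by gcongr; linarith
    have h3 : κ * (r + 1) ^ d * 1 ≤ κ * (r + 1) ^ d * s := by gcongr
    have h4 : 0 ≤ volume.real (D ∩ Metric.closedBall (x₀ + z) r) := measureReal_nonneg
    linarith

theorem exists_crossCovariogram_eq_zero (hD : IsCompact D) (hL : IsCompact L) :
    ∃ R > 0, ∀ z, R ≤ ‖z‖ → crossCovariogram D L z = 0 := by
  obtain ⟨a, ha, hDa⟩ := hD.isBounded.exists_pos_norm_le
  obtain ⟨b, hb, hLb⟩ := hL.isBounded.exists_pos_norm_le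
  refine ⟨a + b + 1, by positivity, fun z hz => ?_⟩
  have : D ∩ (fun y => y + z) '' L = ∅ := by
    rw [eq_empty_iff_forall_notMem]
    rintro _ ⟨hx, y, hy, rfl⟩
    have h1 := hDa _ hx
    have h2 := hLb _ hy
    have h3 := norm_sub_norm_le z (-y)
    rw [norm_neg, sub_neg_eq_add, add_comm z] at h3
    simp only at h1
    linarith
  rw [crossCovariogram, this, measureReal_empty]

/-- With the common centre moved to the origin, the reflection exchanging `z` and `z'` is an
isometry fixing the first ball and carrying one shifted ball to the other. -/
theorem crossCovariogram_closedBall_eq_of_norm_eq (x₀ : Eucl d) (r s : ℝ) {z z' : Eucl d}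
    (h : ‖z‖ = ‖z'‖) :
    crossCovariogram (Metric.closedBall x₀ r) (Metric.closedBall x₀ s) z =
      crossCovariogram (Metric.closedBall x₀ r) (Metric.closedBall x₀ s) z' := by
  have hz : ∀ v : Eucl d,
      crossCovariogram (Metric.closedBall x₀ r) (Metric.closedBall x₀ s) v =
        volume.real (Metric.closedBall 0 r ∩ Metric.closedBall v s) := by
    intro v
    have : Metric.closedBall 0 r ∩ Metric.closedBall v s = (fun x => x + x₀) ⁻¹'
        (Metric.closedBall x₀ r ∩ (fun y => y + v) '' Metric.closedBall x₀ s) := by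
      rw [image_add_right_eq_preimage]
      ext x
      simp [dist_eq_norm, add_sub_right_comm]
    rw [crossCovariogram, measureReal_def, measureReal_def, this, measure_preimage_add_right]
  rw [hz, hz]
  let T := Submodule.reflection (Submodule.span ℝ {z - z'})ᗮ
  have hT : T z = z' := Submodule.reflection_sub h
  have hpre : Metric.closedBall 0 r ∩ Metric.closedBall z s =
      T ⁻¹' (Metric.closedBall 0 r ∩ Metric.closedBall z' s) := by
    rw [preimage_inter, T.preimage_closedBall, T.preimage_closedBall, ← hT]
    simp
  rw [measureReal_def, measureReal_def, hpre, T.measurePreserving.measure_preimage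
    (measurableSet_closedBall.inter measurableSet_closedBall).nullMeasurableSet]

end Covariogram

/-! ### Second moments of integrals of the field. -/

section RandomField

variable {d : ℕ} {Ω : Type*} [MeasurableSpace Ω] {P : Measure Ω} [IsProbabilityMeasure P]
  {A : Eucl d → Ω → ℝ} {K : Eucl d → ℝ} {D L : Set (Eucl d)}

theorem IsWeaklyStationaryField.integral_mul_eq (hA : IsWeaklyStationaryField P A K)
    (x y : Eucl d) : ∫ ω, A x ω * A y ω ∂P = K (x - y) := by
  have := hA.covariance_eq x y
  rw [covariance_eq_sub (hA.memLp_two x) (hA.memLp_two y), hA.centered x, zero_mul, sub_zero] at this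
  exact this

theorem IsWeaklyStationaryField.integral_sq_eq (hA : IsWeaklyStationaryField P A K)
    (x : Eucl d) : ∫ ω, A x ω ^ 2 ∂P = K 0 := by
  have := hA.integral_mul_eq x x
  rw [sub_self] at this
  simpa only [sq] using this

theorem IsWeaklyStationaryField.integral_abs_mul_le (hA : IsWeaklyStationaryField P A K)
    (x y : Eucl d) : ∫ ω, |A x ω * A y ω| ∂P ≤ K 0 := by
  have hx := (hA.memLp_two x).integrable_sq
  have hy := (hA.memLp_two y).integrable_sq
  calc ∫ ω, |A x ω * A y ω| ∂P ≤ ∫ ω, (A x ω ^ 2 + A y ω ^ 2) / 2 ∂P := by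
        refine integral_mono ((hA.memLp_two x).integrable_mul (hA.memLp_two y)).abs
          ((hx.add hy).div_const 2) fun ω => ?_
        change |A x ω * A y ω| ≤ (A x ω ^ 2 + A y ω ^ 2) / 2
        rw [abs_mul, ← sq_abs (A x ω), ← sq_abs (A y ω)]
        nlinarith [sq_nonneg (|A x ω| - |A y ω|)]
    _ = K 0 := by
        rw [integral_div, integral_add hx hy, hA.integral_sq_eq, hA.integral_sq_eq]
        ring

theorem IsWeaklyStationaryField.abs_le (hA : IsWeaklyStationaryField P A K) (z : Eucl d) :
    |K z| ≤ K 0 := by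
  have := hA.integral_mul_eq z 0
  rw [sub_zero] at this
  rw [← this]
  exact abs_integral_le_integral_abs.trans (hA.integral_abs_mul_le z 0)

theorem IsWeaklyStationaryField.aestronglyMeasurable_restrict
    (hA : IsWeaklyStationaryField P A K) (D : Set (Eucl d)) :
    AEStronglyMeasurable (fun p : Eucl d × Ω => A p.1 p.2) ((volume.restrict D).prod P) := by
  have : (volume.restrict D).prod P = ((volume : Measure (Eucl d)).prod P).restrict (D ×ˢ univ) := by
    rw [← Measure.prod_restrict, Measure.restrict_univ]
  rw [this]
  exact hA.jointly_measurable.restrict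

theorem IsWeaklyStationaryField.integrable_mul (hA : IsWeaklyStationaryField P A K)
    (hD : IsCompact D) (hL : IsCompact L) :
    Integrable (fun q : Ω × (Eucl d × Eucl d) => A q.2.1 q.1 * A q.2.2 q.1)
      (P.prod ((volume.restrict D).prod (volume.restrict L))) := by
  have : Fact (volume D < ∞) := ⟨hD.measure_lt_top⟩
  have : Fact (volume L < ∞) := ⟨hL.measure_lt_top⟩
  have hm : AEStronglyMeasurable (fun q : Ω × (Eucl d × Eucl d) => A q.2.1 q.1 * A q.2.2 q.1)
      (P.prod ((volume.restrict D).prod (volume.restrict L))) := by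
    refine AEStronglyMeasurable.mul ?_ ?_
    · exact (hA.aestronglyMeasurable_restrict D).comp_quasiMeasurePreserving
        ((Measure.measurePreserving_swap (μ := P)).quasiMeasurePreserving.comp
          (MeasureTheory.QuasiMeasurePreserving.prodMap (Measure.QuasiMeasurePreserving.id P) Measure.quasiMeasurePreserving_fst))
    · exact (hA.aestronglyMeasurable_restrict L).comp_quasiMeasurePreserving
        ((Measure.measurePreserving_swap (μ := P)).quasiMeasurePreserving.comp
          (MeasureTheory.QuasiMeasurePreserving.prodMap (Measure.QuasiMeasurePreserving.id P) Measure.quasiMeasurePreserving_snd))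
  rw [integrable_prod_iff' hm]
  -- Integrating over `ω` first: the expected absolute product is at most `K 0` for every pair of
  -- points, and the spatial measure is finite.
  refine ⟨Eventually.of_forall fun p =>
    (hA.memLp_two p.1).integrable_mul (hA.memLp_two p.2), ?_⟩
  refine Integrable.of_bound (C := K 0) hm.norm.prod_swap.integral_prod_right' ?_
  refine Eventually.of_forall fun p => ?_
  rw [Real.norm_of_nonneg (integral_nonneg fun _ => norm_nonneg _)]
  exact hA.integral_abs_mul_le p.1 p.2

theorem IsWeaklyStationaryField.integrable_prod (hA : IsWeaklyStationaryField P A K)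
    (hD : IsCompact D) :
    Integrable (fun p : Eucl d × Ω => A p.1 p.2) ((volume.restrict D).prod P) := by
  have : Fact (volume D < ∞) := ⟨hD.measure_lt_top⟩
  have hm := hA.aestronglyMeasurable_restrict D
  rw [integrable_prod_iff hm]
  refine ⟨Eventually.of_forall fun x => (hA.memLp_two x).integrable one_le_two, ?_⟩
  refine Integrable.of_bound (C := 1 + K 0) hm.norm.integral_prod_right' ?_
  refine Eventually.of_forall fun x => ?_
  rw [Real.norm_of_nonneg (integral_nonneg fun _ => norm_nonneg _)]
  calc ∫ ω, ‖A x ω‖ ∂P ≤ ∫ ω, (1 + A x ω ^ 2) ∂P := by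
        refine integral_mono ((hA.memLp_two x).integrable one_le_two).norm
          ((integrable_const _).add (hA.memLp_two x).integrable_sq) fun ω => ?_
        change |A x ω| ≤ 1 + A x ω ^ 2
        rw [← sq_abs]
        nlinarith [sq_nonneg (|A x ω| - 1)]
    _ = 1 + K 0 := by
        rw [integral_add (integrable_const _) (hA.memLp_two x).integrable_sq, hA.integral_sq_eq]
        simp

/-- The square of the integral is the double integral of `A x ω * A y ω`, hence a marginal of an
integrable function. -/
theorem IsWeaklyStationaryField.memLp_setIntegral (hA : IsWeaklyStationaryField P A K)
    (hD : IsCompact D) : MemLp (fun ω => ∫ x in D, A x ω) 2 P := by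
  have hm : AEStronglyMeasurable (fun ω => ∫ x in D, A x ω) P :=
    (hA.aestronglyMeasurable_restrict D).prod_swap.integral_prod_right'
  rw [memLp_two_iff_integrable_sq hm]
  have := (hA.integrable_mul hD hD).integral_prod_left
  refine this.congr (Eventually.of_forall fun ω => ?_)
  simp only [sq]
  exact integral_prod_mul (fun x => A x ω) (fun x => A x ω)

theorem IsWeaklyStationaryField.integral_setIntegral (hA : IsWeaklyStationaryField P A K)
    (hD : IsCompact D) : ∫ ω, (∫ x in D, A x ω) ∂P = 0 := by
  rw [← integral_integral_swap (f := fun x ω => A x ω) (hA.integrable_prod hD)]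
  simp [hA.centered]

theorem IsWeaklyStationaryField.covariance_setIntegral (hA : IsWeaklyStationaryField P A K)
    (hD : IsCompact D) (hL : IsCompact L) :
    cov[fun ω => ∫ x in D, A x ω, fun ω => ∫ x in L, A x ω; P] =
      ∫ p, K (p.1 - p.2) ∂((volume.restrict D).prod (volume.restrict L)) := by
  rw [covariance_eq_sub (hA.memLp_setIntegral hD) (hA.memLp_setIntegral hL),
    hA.integral_setIntegral hD, zero_mul, sub_zero]
  calc ∫ ω, (∫ x in D, A x ω) * (∫ x in L, A x ω) ∂P
      = ∫ ω, (∫ p, A p.1 ω * A p.2 ω ∂((volume.restrict D).prod (volume.restrict L))) ∂P := by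
        refine integral_congr_ae (Eventually.of_forall fun ω => ?_)
        exact (integral_prod_mul (fun x => A x ω) (fun x => A x ω)).symm
    _ = ∫ p, (∫ ω, A p.1 ω * A p.2 ω ∂P) ∂((volume.restrict D).prod (volume.restrict L)) :=
        integral_integral_swap (hA.integrable_mul hD hL)
    _ = _ := by simp only [hA.integral_mul_eq]

theorem integral_prod_sub_eq_integral_mul_crossCovariogram (hK : Measurable K) {B : ℝ}
    (hB : ∀ z, |K z| ≤ B) (hD : IsCompact D) (hL : IsCompact L) :
    ∫ p, K (p.1 - p.2) ∂((volume.restrict D).prod (volume.restrict L)) =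
      ∫ z, K z * crossCovariogram D L z := by
  have : Fact (volume D < ∞) := ⟨hD.measure_lt_top⟩
  have : Fact (volume L < ∞) := ⟨hL.measure_lt_top⟩
  obtain ⟨a, ha, hDa⟩ := hD.isBounded.exists_pos_norm_le
  obtain ⟨b, hb, hLb⟩ := hL.isBounded.exists_pos_norm_le
  have hKp : Measurable fun p : Eucl d × Eucl d => K (p.1 - p.2) :=
    hK.comp (measurable_fst.sub measurable_snd)
  have hint : Integrable (fun p : Eucl d × Eucl d => K (p.1 - p.2))
      ((volume.restrict D).prod (volume.restrict L)) :=
    Integrable.of_bound hKp.aestronglyMeasurable B (Eventually.of_forall fun p => hB _)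
  -- The domain `D × L` in the coordinates `(x, z)`, `z = x - y`. It forces `‖z‖ ≤ a + b`, which
  -- gives the integrable majorant for Fubini.
  let S : Set (Eucl d × Eucl d) := {p | p.1 ∈ D ∧ p.1 - p.2 ∈ L}
  have hS : MeasurableSet S := (measurable_fst hD.measurableSet).inter
    ((measurable_fst.sub measurable_snd) hL.measurableSet)
  let F : Eucl d → Eucl d → ℝ := fun x z => S.indicator (fun p => K p.2) (x, z)
  have hF : Integrable (Function.uncurry F)
      ((volume : Measure (Eucl d)).prod (volume : Measure (Eucl d))) := by
    have h1 : Integrable (D.indicator (fun _ => (1 : ℝ))) volume :=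
      (integrable_indicator_iff hD.measurableSet).2 (integrableOn_const hD.measure_lt_top.ne)
    have h2 : Integrable ((Metric.closedBall (0 : Eucl d) (a + b)).indicator (fun _ => B)) volume :=
      (integrable_indicator_iff measurableSet_closedBall).2
        (integrableOn_const measure_closedBall_lt_top.ne)
    refine (h1.mul_prod h2).mono' ((hK.comp measurable_snd).indicator hS).aestronglyMeasurable
      (Eventually.of_forall fun ⟨x, z⟩ => ?_)
    have hB0 : 0 ≤ B := (abs_nonneg _).trans (hB 0)
    by_cases hp : (x, z) ∈ S
    · have hz : z ∈ Metric.closedBall (0 : Eucl d) (a + b) := by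
        rw [mem_closedBall_zero_iff]
        have e1 := hDa _ hp.1
        have e2 := hLb _ hp.2
        have e3 := norm_sub_le x (x - z)
        rw [sub_sub_cancel] at e3
        simp only at e1 e2
        linarith
      have hx : x ∈ D := hp.1
      simp only [F, Function.uncurry, indicator_of_mem hp, indicator_of_mem hx,
        indicator_of_mem hz, one_mul]
      exact hB z
    · simp only [F, Function.uncurry, indicator_of_notMem hp, norm_zero]
      exact mul_nonneg (indicator_nonneg (fun _ _ => zero_le_one) _)
        (indicator_nonneg (fun _ _ => hB0) _)
  have hleft : ∀ x, ∫ z, F x z = D.indicator (fun x => ∫ y in L, K (x - y)) x := by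
    intro x
    by_cases hx : x ∈ D
    · rw [indicator_of_mem hx, ← integral_indicator hL.measurableSet,
        ← integral_sub_left_eq_self _ volume x]
      refine integral_congr_ae (Eventually.of_forall fun z => ?_)
      have hiff : (x, x - z) ∈ S ↔ z ∈ L := by simp [S, hx]
      by_cases hz : z ∈ L
      · simp only [F, indicator_of_mem (hiff.2 hz), indicator_of_mem hz]
      · simp only [F, indicator_of_notMem (mt hiff.1 hz), indicator_of_notMem hz]
    · simp [F, S, indicator, hx]
  have hright : ∀ z, ∫ x, F x z = K z * crossCovariogram D L z := by
    intro z
    have hm : MeasurableSet (D ∩ (fun x => x - z) ⁻¹' L) :=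
      hD.measurableSet.inter (measurable_sub_const z hL.measurableSet)
    have : ∀ x, F x z = (D ∩ (fun x => x - z) ⁻¹' L).indicator (fun _ => K z) x := fun x => rfl
    simp only [this]
    rw [integral_indicator hm, setIntegral_const, smul_eq_mul, mul_comm, crossCovariogram,
      image_add_right_eq_preimage]
  rw [integral_prod _ hint, ← integral_indicator hD.measurableSet]
  simp only [← hleft]
  rw [integral_integral_swap hF]
  simp only [hright]

theorem crossCovariogram_smul {t : ℝ} (ht : 0 < t) (D L : Set (Eucl d)) (z : Eucl d) :
    crossCovariogram (t • D) (t • L) z = t ^ d * crossCovariogram D L (t⁻¹ • z) := by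
  have : (t • D) ∩ ((fun y => y + z) '' (t • L)) = t • (D ∩ (fun y => y + t⁻¹ • z) '' L) := by
    rw [image_add_right_eq_preimage, image_add_right_eq_preimage]
    ext x
    simp only [mem_inter_iff, mem_smul_set_iff_inv_smul_mem₀ ht.ne', mem_preimage, smul_sub]
  rw [crossCovariogram, this, measureReal_def, Measure.addHaar_smul, ENNReal.toReal_mul,
    crossCovariogram, measureReal_def, ENNReal.toReal_ofReal (abs_nonneg _),
    finrank_euclideanSpace_fin, abs_of_pos (by positivity)]

theorem IsWeaklyStationaryField.covariance_setIntegral_smul (hA : IsWeaklyStationaryField P A K)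
    (hD : IsCompact D) (hL : IsCompact L) {t : ℝ} (ht : 0 < t) :
    cov[fun ω => ∫ x in t • D, A x ω, fun ω => ∫ x in t • L, A x ω; P] =
      t ^ d * ∫ z, K z * crossCovariogram D L (t⁻¹ • z) := by
  rw [hA.covariance_setIntegral (hD.smul t) (hL.smul t),
    integral_prod_sub_eq_integral_mul_crossCovariogram hA.measurable_cov hA.abs_le
      (hD.smul t) (hL.smul t), ← integral_const_mul]
  simp only [crossCovariogram_smul ht]
  refine integral_congr_ae (Eventually.of_forall fun z => ?_)
  simp only
  ring

end RandomField

/-! ### Polar coordinates. -/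

section Polar

variable {d : ℕ}

/-- The radial part of Lebesgue measure on `ℝ^d` in polar coordinates. -/
noncomputable abbrev radialMeasure (d : ℕ) : Measure (Ioi (0 : ℝ)) :=
  Measure.volumeIoiPow (Module.finrank ℝ (Eucl d) - 1)

instance : IsFiniteMeasure (surfaceMeasure d) := by
  unfold surfaceMeasure; infer_instance

theorem homeomorphUnitSphereProd_snd_smul_fst (z : ({0}ᶜ : Set (Eucl d))) :
    ((homeomorphUnitSphereProd (Eucl d) z).2 : ℝ) •
      ((homeomorphUnitSphereProd (Eucl d) z).1 : Eucl d) = z := by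
  have : ‖(z : Eucl d)‖ ≠ 0 := norm_ne_zero_iff.2 z.2
  simp [smul_smul, this]

theorem integral_eq_integral_sphere_integral_radial [Nontrivial (Eucl d)] {f : Eucl d → ℝ}
    (hf : Integrable f) :
    ∫ z, f z = ∫ θ, (∫ r, f ((r : ℝ) • (θ : Eucl d)) ∂(radialMeasure d)) ∂(surfaceMeasure d) := by
  have hmp := (volume : Measure (Eucl d)).measurePreserving_homeomorphUnitSphereProd
  have hemb := (homeomorphUnitSphereProd (Eucl d)).measurableEmbedding
  let G : Metric.sphere (0 : Eucl d) 1 × Ioi (0 : ℝ) → ℝ := fun p => f ((p.2 : ℝ) • (p.1 : Eucl d))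
  have hG : ∀ z, G (homeomorphUnitSphereProd (Eucl d) z) = f z := fun z =>
    congrArg f (homeomorphUnitSphereProd_snd_smul_fst z)
  have hint : Integrable G ((surfaceMeasure d).prod (radialMeasure d)) := by
    rw [surfaceMeasure, ← hmp.integrable_comp_emb hemb]
    have : G ∘ homeomorphUnitSphereProd (Eucl d) = fun z : ({0}ᶜ : Set (Eucl d)) => f z := funext hG
    rw [this]
    exact (integrableOn_iff_comap_subtypeVal (measurableSet_singleton _).compl).1 hf.integrableOn
  calc ∫ z, f z = ∫ z : ({0}ᶜ : Set (Eucl d)), f z ∂(volume.comap Subtype.val) := by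
        rw [integral_subtype_comap (measurableSet_singleton _).compl f,
          restrict_compl_singleton]
    _ = ∫ p, G p ∂((surfaceMeasure d).prod (radialMeasure d)) := by
        rw [surfaceMeasure, ← hmp.integral_comp hemb]
        simp only [hG]
    _ = _ := integral_prod _ hint

theorem sphereArea_ne_zero [Nontrivial (Eucl d)] : sphereArea d ≠ 0 := by
  rw [sphereArea, measureReal_def, ENNReal.toReal_ne_zero]
  exact ⟨by simp [surfaceMeasure, -Measure.toSphere_apply_univ], measure_ne_top _ _⟩

end Polar

/-! ### Ball integrals of `K`, the sphere representation and its limit. -/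

section BallIntegral

variable {d : ℕ} {K : Eucl d → ℝ} {B : ℝ}

theorem setOf_norm_le_eq_closedBall (t : ℝ) : {z : Eucl d | ‖z‖ ≤ t} = Metric.closedBall 0 t := by
  ext; simp

theorem measurable_ballIntegral (hK : Measurable K) : Measurable (ballIntegral K) := by
  have : ballIntegral K = fun t => ∫ z, {p : ℝ × Eucl d | ‖p.2‖ ≤ p.1}.indicator
      (fun p => K p.2) (t, z) := by
    ext t
    rw [ballIntegral, ← integral_indicator (by
      rw [setOf_norm_le_eq_closedBall]; exact measurableSet_closedBall)]
    rfl
  rw [this]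
  refine (StronglyMeasurable.integral_prod_right' (f := {p : ℝ × Eucl d | ‖p.2‖ ≤ p.1}.indicator
      (fun p => K p.2)) ?_).measurable
  exact ((hK.comp measurable_snd).indicator
    (measurableSet_le measurable_snd.norm measurable_fst)).stronglyMeasurable

theorem abs_ballIntegral_le (hB : ∀ z, |K z| ≤ B) {t : ℝ} (ht : 0 < t) :
    |ballIntegral K t| ≤ (B * volume.real (Metric.ball (0 : Eucl d) 1)) * t ^ (d : ℝ) := by
  rw [ballIntegral, setOf_norm_le_eq_closedBall]
  refine (norm_setIntegral_le_of_norm_le_const (f := K) measure_closedBall_lt_top fun z _ => hB z).trans_eq ?_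
  rw [measureReal_def, Measure.addHaar_closedBall _ _ ht.le, ENNReal.toReal_mul,
    ENNReal.toReal_ofReal (by positivity), finrank_euclideanSpace_fin, Real.rpow_natCast,
    measureReal_def]
  ring

theorem integrable_mul_comp_smul (hK : Measurable K) (hB : ∀ z, |K z| ≤ B) {g : Eucl d → ℝ}
    (hg : Continuous g) {R : ℝ} (h0 : ∀ z, R ≤ ‖z‖ → g z = 0) {t : ℝ} (ht : 0 < t) :
    Integrable fun z => K z * g (t⁻¹ • z) := by
  have hcs : HasCompactSupport g := by
    refine HasCompactSupport.of_support_subset_isCompact (isCompact_closedBall (0 : Eucl d) R) ?_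
    intro z hz
    rw [mem_closedBall_zero_iff]
    by_contra h
    exact hz (h0 z (not_le.1 h).le)
  have h1 : Integrable fun z => g (t⁻¹ • z) :=
    (hg.integrable_of_hasCompactSupport hcs).comp_smul (inv_ne_zero ht.ne')
  exact h1.bdd_mul hK.aestronglyMeasurable (Eventually.of_forall hB)

section SphereIntegral

variable {g : Eucl d → ℝ} {C : NNReal} {R : ℝ}

theorem lipschitzWith_comp_smul_sphere (hg : LipschitzWith C g)
    (θ : Metric.sphere (0 : Eucl d) 1) : LipschitzWith C fun s : ℝ => g (s • (θ : Eucl d)) := by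
  have h1 : LipschitzWith 1 fun s : ℝ => s • (θ : Eucl d) := by
    refine LipschitzWith.of_dist_le_mul fun a b => ?_
    rw [dist_eq_norm, ← sub_smul, norm_smul, norm_eq_of_mem_sphere θ, dist_eq_norm]
    simp
  simpa [Function.comp_def] using hg.comp h1

theorem comp_smul_sphere_eq_zero (h0 : ∀ z, R ≤ ‖z‖ → g z = 0)
    (θ : Metric.sphere (0 : Eucl d) 1) : ∀ r ≥ R, g (r • (θ : Eucl d)) = 0 := by
  intro r hr
  refine h0 _ ?_
  rw [norm_smul, norm_eq_of_mem_sphere θ, mul_one]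
  exact hr.trans (le_abs_self r)

theorem measurable_deriv_comp_smul_sphere (hg : Continuous g) :
    Measurable fun p : Metric.sphere (0 : Eucl d) 1 × ℝ =>
      deriv (fun s : ℝ => g (s • (p.1 : Eucl d))) p.2 := by
  refine measurable_deriv_with_param
    (f := fun (θ : Metric.sphere (0 : Eucl d) 1) (s : ℝ) => g (s • (θ : Eucl d))) ?_
  simp only [Function.uncurry_def]
  fun_prop

theorem IsRadial.eq_comp_norm (hrad : IsRadial g) (θ : Metric.sphere (0 : Eucl d) 1)
    (z : Eucl d) : g z = g (‖z‖ • (θ : Eucl d)) := by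
  obtain ⟨k, hk⟩ := hrad
  rw [hk, hk, norm_smul, norm_eq_of_mem_sphere θ, norm_norm, mul_one]

/-- For radial `K`, the ball integral is `sphereArea d` times a one-dimensional radial integral, so
the layer cake formula on each ray, with `ρ r = r / t`, produces it directly. -/
theorem integral_mul_eq_sphere_integral_of_isRadial_left [Nontrivial (Eucl d)] (hK : Measurable K)
    (hB : ∀ z, |K z| ≤ B) (hrad : IsRadial K)
    (hg : LipschitzWith C g) (h0 : ∀ z, R ≤ ‖z‖ → g z = 0) {t : ℝ} (ht : 0 < t) :
    ∫ z, K z * g (t⁻¹ • z) = (1 / sphereArea d) * ∫ θ : Metric.sphere (0 : Eucl d) 1,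
      (∫ l in Ioi (0 : ℝ), -deriv (fun s : ℝ => g (s • (θ : Eucl d))) l * ballIntegral K (t * l))
        ∂(surfaceMeasure d) := by
  obtain ⟨v, hv⟩ := NormedSpace.sphere_nonempty (x := (0 : Eucl d)) (r := 1) |>.2 zero_le_one
  let θ₀ : Metric.sphere (0 : Eucl d) 1 := ⟨v, hv⟩
  let k : Ioi (0 : ℝ) → ℝ := fun r => K ((r : ℝ) • (θ₀ : Eucl d))
  have hk : ∀ (θ : Metric.sphere (0 : Eucl d) 1) (r : Ioi (0 : ℝ)),
      K ((r : ℝ) • (θ : Eucl d)) = k r := by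
    intro θ r
    rw [hrad.eq_comp_norm θ₀, norm_smul, norm_eq_of_mem_sphere θ, mul_one, Real.norm_eq_abs,
      abs_of_pos r.2]
  have hkm : Measurable k := hK.comp (measurable_subtype_coe.smul_const _)
  have hset : ∀ s : ℝ, MeasurableSet {r : Ioi (0 : ℝ) | t⁻¹ * r ≤ s} := fun s =>
    measurableSet_le (measurable_subtype_coe.const_mul _) measurable_const
  have hball : ∀ l, ballIntegral K (t * l) =
      sphereArea d * ∫ r in {r : Ioi (0 : ℝ) | t⁻¹ * r ≤ l}, k r ∂(radialMeasure d) := by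
    intro l
    have hms : MeasurableSet {z : Eucl d | ‖z‖ ≤ t * l} := by
      rw [setOf_norm_le_eq_closedBall]; exact measurableSet_closedBall
    have hint : Integrable ({z : Eucl d | ‖z‖ ≤ t * l}.indicator K) := by
      rw [integrable_indicator_iff hms, setOf_norm_le_eq_closedBall]
      exact Measure.integrableOn_of_bounded measure_closedBall_lt_top.ne hK.aestronglyMeasurable
        (Eventually.of_forall hB)
    rw [ballIntegral, ← integral_indicator hms,
      integral_eq_integral_sphere_integral_radial hint]
    have e : ∀ (θ : Metric.sphere (0 : Eucl d) 1) (r : Ioi (0 : ℝ)),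
        {z : Eucl d | ‖z‖ ≤ t * l}.indicator K ((r : ℝ) • (θ : Eucl d)) =
          {r : Ioi (0 : ℝ) | t⁻¹ * r ≤ l}.indicator k r := by
      intro θ r
      have hiff : (r : ℝ) • (θ : Eucl d) ∈ {z : Eucl d | ‖z‖ ≤ t * l} ↔
          r ∈ {r : Ioi (0 : ℝ) | t⁻¹ * r ≤ l} := by
        rw [mem_ofPred_eq, mem_ofPred_eq, norm_smul, norm_eq_of_mem_sphere θ, mul_one,
          Real.norm_eq_abs, abs_of_pos r.2, inv_mul_le_iff₀ ht]
      by_cases hr : r ∈ {r : Ioi (0 : ℝ) | t⁻¹ * r ≤ l}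
      · rw [indicator_of_mem hr, indicator_of_mem (hiff.2 hr), hk]
      · rw [indicator_of_notMem hr, indicator_of_notMem (mt hiff.1 hr)]
    simp only [e]
    rw [integral_const, integral_indicator (hset l), smul_eq_mul, sphereArea]
  have hkint : IntegrableOn k {r | t⁻¹ * r ≤ R} (radialMeasure d) := by
    refine Measure.integrableOn_of_bounded (M := B) ?_ hkm.aestronglyMeasurable
      (Eventually.of_forall fun r => hB _)
    -- The absolute value allows negative `R`; the `+ 1` places the set in an open initial segment,
    -- whose measure is explicit.
    let x : Ioi (0 : ℝ) := ⟨t * |R| + 1, by simp only [mem_Ioi]; positivity⟩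
    refine ((measure_mono (t := Iio x) fun r hr => ?_).trans_lt ?_).ne
    · rw [mem_ofPred_eq, inv_mul_le_iff₀ ht] at hr
      change (r : ℝ) < t * |R| + 1
      nlinarith [mul_le_mul_of_nonneg_left (le_abs_self R) ht.le]
    · rw [Measure.volumeIoiPow_apply_Iio]; exact ENNReal.ofReal_lt_top
  rw [integral_eq_integral_sphere_integral_radial
    (integrable_mul_comp_smul hK hB hg.continuous h0 ht), ← integral_const_mul]
  refine integral_congr_ae (Eventually.of_forall fun θ => ?_)
  have e := integral_mul_comp_eq_integral_deriv (ν := radialMeasure d)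
    (ρ := fun r : Ioi (0 : ℝ) => t⁻¹ * r) (measurable_subtype_coe.const_mul _)
    (fun r => by have := r.2.out; positivity) hkint
    (lipschitzWith_comp_smul_sphere hg θ) (comp_smul_sphere_eq_zero h0 θ)
  simp only [hk, smul_smul, hball]
  rw [e, ← integral_const_mul]
  refine integral_congr_ae (Eventually.of_forall fun l => ?_)
  have := sphereArea_ne_zero (d := d)
  simp only
  field_simp

/-- For radial `g`, the layer cake formula on all of space gives the same value for every `θ`, so
averaging over the sphere changes nothing. -/
theorem integral_mul_eq_sphere_integral_of_isRadial_right [Nontrivial (Eucl d)]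
    (hK : Measurable K) (hB : ∀ z, |K z| ≤ B) (hrad : IsRadial g)
    (hg : LipschitzWith C g) (h0 : ∀ z, R ≤ ‖z‖ → g z = 0) {t : ℝ} (ht : 0 < t) :
    ∫ z, K z * g (t⁻¹ • z) = (1 / sphereArea d) * ∫ θ : Metric.sphere (0 : Eucl d) 1,
      (∫ l in Ioi (0 : ℝ), -deriv (fun s : ℝ => g (s • (θ : Eucl d))) l * ballIntegral K (t * l))
        ∂(surfaceMeasure d) := by
  have key : ∀ θ : Metric.sphere (0 : Eucl d) 1,
      ∫ l in Ioi (0 : ℝ), -deriv (fun s : ℝ => g (s • (θ : Eucl d))) l * ballIntegral K (t * l) =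
        ∫ z, K z * g (t⁻¹ • z) := by
    intro θ
    have hset : ∀ l, {z : Eucl d | ‖t⁻¹ • z‖ ≤ l} = {z : Eucl d | ‖z‖ ≤ t * l} := by
      intro l
      ext z
      rw [mem_ofPred_eq, mem_ofPred_eq, norm_smul, Real.norm_eq_abs, abs_of_pos (inv_pos.2 ht),
        inv_mul_le_iff₀ ht]
    have hint : IntegrableOn K {z | ‖t⁻¹ • z‖ ≤ R} := by
      rw [hset, setOf_norm_le_eq_closedBall]
      exact Measure.integrableOn_of_bounded measure_closedBall_lt_top.ne hK.aestronglyMeasurable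
        (Eventually.of_forall hB)
    have e := integral_mul_comp_eq_integral_deriv (ν := (volume : Measure (Eucl d)))
      (ρ := fun z : Eucl d => ‖t⁻¹ • z‖) (measurable_const_smul t⁻¹).norm
      (fun z => norm_nonneg _) hint
      (lipschitzWith_comp_smul_sphere hg θ) (comp_smul_sphere_eq_zero h0 θ)
    simp only [← hrad.eq_comp_norm θ, hset] at e
    exact e.symm
  simp only [key]
  rw [integral_const, smul_eq_mul, ← sphereArea, ← mul_assoc,
    one_div_mul_cancel sphereArea_ne_zero, one_mul]

/-- Dominated convergence twice, in `l` and in `θ`; the bound for the inner integral does not depend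
on `θ`, and the sphere has finite measure. -/
theorem tendsto_integral_sphere_div (hg : LipschitzWith C g) (h0 : ∀ z, R ≤ ‖z‖ → g z = 0)
    {W : ℝ → ℝ} (hWm : Measurable W) {α δ b : ℝ} (hα : -1 < α) (hW : RegularlyVarying W α)
    (hδ : α ≤ δ) (hWb : ∀ t > 0, |W t| ≤ b * t ^ δ) :
    Tendsto (fun t => ∫ θ : Metric.sphere (0 : Eucl d) 1,
      (∫ l in Ioi (0 : ℝ), -deriv (fun s : ℝ => g (s • (θ : Eucl d))) l * (W (t * l) / W t))
        ∂(surfaceMeasure d)) atTop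
      (𝓝 (∫ θ : Metric.sphere (0 : Eucl d) 1,
        (∫ l in Ioi (0 : ℝ), -deriv (fun s : ℝ => g (s • (θ : Eucl d))) l * l ^ α)
          ∂(surfaceMeasure d))) := by
  -- This `ε` gives the exponent `(α - 1) / 2`, which exceeds `-1` exactly because `α > -1`.
  obtain ⟨c, T, hT0, hT⟩ := hW.exists_bound hδ hWb (ε := (α + 1) / 2) (by linarith) (M := R)
  have hβ : -1 < α - (α + 1) / 2 := by linarith
  have hbd : ∀ t ≥ T, ∀ l, 0 < l → l ≤ R →
      |W (t * l) / W t| ≤ c * l ^ (α - (α + 1) / 2) := by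
    intro t ht l hl hlR
    rw [abs_div, abs_of_pos (hT t ht).1, div_le_iff₀ (hT t ht).1]
    exact (hT t ht).2 l hl hlR
  refine tendsto_integral_filter_of_dominated_convergence
    (fun _ => ∫ l in Ioi (0 : ℝ),
      (Iic R).indicator (fun l => (C * c) * l ^ (α - (α + 1) / 2)) l) ?_ ?_
    (integrable_const _) ?_
  · refine Eventually.of_forall fun t => ?_
    refine (StronglyMeasurable.integral_prod_right' (f := fun p : Metric.sphere (0 : Eucl d) 1 × ℝ =>
      -deriv (fun s : ℝ => g (s • (p.1 : Eucl d))) p.2 * (W (t * p.2) / W t)) ?_).aestronglyMeasurable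
    exact ((measurable_deriv_comp_smul_sphere hg.continuous).neg.mul
      ((hWm.comp (measurable_snd.const_mul t)).div_const _)).stronglyMeasurable
  · filter_upwards [eventually_ge_atTop T] with t ht
    exact Eventually.of_forall fun θ => abs_integral_neg_deriv_mul_le
      (lipschitzWith_comp_smul_sphere hg θ) (comp_smul_sphere_eq_zero h0 θ) hβ (hbd t ht)
  · exact Eventually.of_forall fun θ => tendsto_integral_neg_deriv_mul
      (lipschitzWith_comp_smul_sphere hg θ) (comp_smul_sphere_eq_zero h0 θ) hWm hW hβ hbd

theorem integrable_sphere_integral_neg_deriv_mul_rpow (hg : LipschitzWith C g)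
    (h0 : ∀ z, R ≤ ‖z‖ → g z = 0) {α : ℝ} (hα : -1 < α) :
    Integrable (fun θ : Metric.sphere (0 : Eucl d) 1 =>
      ∫ l in Ioi (0 : ℝ), -deriv (fun s : ℝ => g (s • (θ : Eucl d))) l * l ^ α)
      (surfaceMeasure d) := by
  refine Integrable.of_bound (C := ∫ l in Ioi (0 : ℝ),
    (Iic R).indicator (fun l => (C * 1) * l ^ α) l) ?_ (Eventually.of_forall fun θ => ?_)
  · refine (StronglyMeasurable.integral_prod_right' (f := fun p : Metric.sphere (0 : Eucl d) 1 × ℝ =>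
      -deriv (fun s : ℝ => g (s • (p.1 : Eucl d))) p.2 * p.2 ^ α) ?_).aestronglyMeasurable
    exact ((measurable_deriv_comp_smul_sphere hg.continuous).neg.mul
      (measurable_snd.pow_const α)).stronglyMeasurable
  · refine abs_integral_neg_deriv_mul_le (W := fun l => l ^ α)
      (lipschitzWith_comp_smul_sphere hg θ) (comp_smul_sphere_eq_zero h0 θ) hα fun l hl _ => ?_
    rw [one_mul, abs_of_pos (Real.rpow_pos_of_pos hl α)]

end SphereIntegral

end BallIntegral

/-! ### Assembly. -/

/-- All that the limit argument needs from the two cases. -/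
theorem exists_lipschitzWith_crossCovariogram_of_case {d : ℕ} {K : Eucl d → ℝ}
    {𝒟 : Set (Set (Eucl d))}
    (hcase : (IsRadial K ∧ 𝒟 = compactFinitePerimeter d) ∨ (∃ x₀ : Eucl d, 𝒟 = concentricBalls x₀))
    {D L : Set (Eucl d)} (hD : D ∈ 𝒟) (hL : L ∈ 𝒟) :
    IsCompact D ∧ IsCompact L ∧ (∃ C, LipschitzWith C (crossCovariogram D L)) ∧
      (IsRadial K ∨ IsRadial (crossCovariogram D L)) := by
  rcases hcase with ⟨hrad, rfl⟩ | ⟨x₀, rfl⟩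
  · exact ⟨hD.1, hL.1,
      ⟨_, lipschitzWith_crossCovariogram_of_perimeter_lt_top hD.1 hL.1 hL.2⟩, Or.inl hrad⟩
  · have hball : ∀ r : ℝ, {x : Eucl d | ‖x - x₀‖ ≤ r} = Metric.closedBall x₀ r := by
      intro r; ext x; simp [dist_eq_norm]
    obtain ⟨r, hr, rfl⟩ := hD
    obtain ⟨s, hs, rfl⟩ := hL
    rw [hball, hball]
    have hc : IsCompact (Metric.closedBall x₀ r) := isCompact_closedBall x₀ r
    refine ⟨hc, isCompact_closedBall x₀ s,
      lipschitzWith_crossCovariogram_closedBall hc x₀ hs, Or.inr ?_⟩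
    -- A radial profile is read off along a unit vector; the zero-dimensional space has none.
    rcases subsingleton_or_nontrivial (Eucl d) with hsub | hnt
    · exact ⟨fun _ => crossCovariogram _ _ 0, fun z => by rw [Subsingleton.elim z 0]⟩
    · obtain ⟨v, hv⟩ := exists_norm_eq (Eucl d) (zero_le_one (α := ℝ))
      refine ⟨fun a => crossCovariogram (Metric.closedBall x₀ r) (Metric.closedBall x₀ s) (a • v), fun z => ?_⟩
      exact crossCovariogram_closedBall_eq_of_norm_eq x₀ r s (by simp [norm_smul, hv])

/-- Here `n • D` is the `n`-fold Minkowski sum, in general larger than the dilate of `D` by `n`. -/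
theorem IsCompact.nsmul_set {d : ℕ} {D : Set (Eucl d)} (hD : IsCompact D) (n : ℕ) :
    IsCompact (n • D) := by
  induction n with
  | zero => rw [zero_nsmul]; exact isCompact_singleton
  | succ n ih => rw [succ_nsmul]; exact ih.add hD

/-- The limit relation, where the square integrability of the integrals over `t • D` and `t • L` is
stated for real dilations `t > 0`. -/
theorem tendsto_covariance_normalizedIntegral {d : ℕ} (hd : 1 ≤ d)
    {Ω : Type*} [MeasurableSpace Ω] (P : Measure Ω) [IsProbabilityMeasure P]
    (A : Eucl d → Ω → ℝ) (K : Eucl d → ℝ) (hA : IsWeaklyStationaryField P A K)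
    (𝒟 : Set (Set (Eucl d)))
    (hcase : (IsRadial K ∧ 𝒟 = compactFinitePerimeter d) ∨ (∃ x₀ : Eucl d, 𝒟 = concentricBalls x₀))
    (α : ℝ) (hα : -1 < α) (hα' : α ≤ d)
    (hw : RegularlyVarying (ballIntegral K) α) :
    ∀ D ∈ 𝒟, ∀ L ∈ 𝒟,
      (∀ t : ℝ, 0 < t → MemLp (fun ω => ∫ x in t • D, A x ω) 2 P ∧
        MemLp (fun ω => ∫ x in t • L, A x ω) 2 P) ∧
      (∀ θ : Metric.sphere (0 : Eucl d) 1,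
        (∀ᵐ l ∂(volume.restrict (Ioi (0 : ℝ))),
          DifferentiableAt ℝ (fun s : ℝ => crossCovariogram D L (s • (θ : Eucl d))) l) ∧
        IntegrableOn (fun l : ℝ => radialDeriv D L θ l) (Ioi 0) ∧
        IntegrableOn (fun l : ℝ => (-radialDeriv D L θ l) * l ^ α) (Ioi 0)) ∧
      Integrable (fun θ : Metric.sphere (0 : Eucl d) 1 => radialIntegral D L α θ)
        (surfaceMeasure d) ∧
      Tendsto (fun t : ℝ => cov[normalizedIntegral A K D t, normalizedIntegral A K L t; P])
        atTop
        (𝓝 ((1 / sphereArea d) *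
          ∫ θ : Metric.sphere (0 : Eucl d) 1, radialIntegral D L α θ ∂(surfaceMeasure d))) := by
  have : Nontrivial (Eucl d) := Module.nontrivial_of_finrank_pos (R := ℝ) (by
    rw [finrank_euclideanSpace_fin]; exact hd)
  intro D hDmem L hLmem
  obtain ⟨hD, hL, ⟨C, hg⟩, hrad⟩ := exists_lipschitzWith_crossCovariogram_of_case hcase hDmem hLmem
  obtain ⟨R, -, h0⟩ := exists_crossCovariogram_eq_zero hD hL
  have hB := hA.abs_le
  have hK := hA.measurable_cov
  refine ⟨fun t _ => ⟨hA.memLp_setIntegral (hD.smul t), hA.memLp_setIntegral (hL.smul t)⟩,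
    fun θ => ⟨?_, ?_, ?_⟩, ?_, ?_⟩
  · exact ae_restrict_of_ae (lipschitzWith_comp_smul_sphere hg θ).ae_differentiableAt_real
  · exact integrableOn_deriv_of_lipschitzWith (lipschitzWith_comp_smul_sphere hg θ)
      (comp_smul_sphere_eq_zero h0 θ)
  · exact integrableOn_neg_deriv_mul_rpow (lipschitzWith_comp_smul_sphere hg θ)
      (comp_smul_sphere_eq_zero h0 θ) hα
  · exact integrable_sphere_integral_neg_deriv_mul_rpow hg h0 hα
  · have hkey : ∀ t > 0, ∫ z, K z * crossCovariogram D L (t⁻¹ • z) =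
        (1 / sphereArea d) * ∫ θ : Metric.sphere (0 : Eucl d) 1,
          (∫ l in Ioi (0 : ℝ), -deriv (fun s : ℝ => crossCovariogram D L (s • (θ : Eucl d))) l *
            ballIntegral K (t * l)) ∂(surfaceMeasure d) := by
      intro t ht
      rcases hrad with hrad | hrad
      · exact integral_mul_eq_sphere_integral_of_isRadial_left hK hB hrad hg h0 ht
      · exact integral_mul_eq_sphere_integral_of_isRadial_right hK hB hrad hg h0 ht
    have hlim := (tendsto_integral_sphere_div hg h0 (measurable_ballIntegral hK) hα hw hα'
      fun t ht => abs_ballIntegral_le hB ht).const_mul (1 / sphereArea d)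
    refine hlim.congr' ?_
    obtain ⟨ℓ, ⟨-, ⟨a, ha, hℓ⟩, -⟩, hwℓ⟩ := hw
    filter_upwards [eventually_ge_atTop a] with t hta
    have ht : 0 < t := ha.trans_le hta
    have hwt : 0 < ballIntegral K t := by
      rw [hwℓ t ht]
      exact mul_pos (hℓ t hta) (Real.rpow_pos_of_pos ht α)
    -- Positivity of `w_t`, available for large `t` only, lets the two half powers recombine.
    have hsq : (t ^ ((d : ℝ) / 2) * ballIntegral K t ^ ((1 : ℝ) / 2)) *
        (t ^ ((d : ℝ) / 2) * ballIntegral K t ^ ((1 : ℝ) / 2)) = t ^ d * ballIntegral K t := by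
      rw [mul_mul_mul_comm, ← Real.rpow_add ht, ← Real.rpow_add hwt]
      norm_num
    have hcov : cov[normalizedIntegral A K D t, normalizedIntegral A K L t; P] =
        (∫ z, K z * crossCovariogram D L (t⁻¹ • z)) / ballIntegral K t := by
      unfold normalizedIntegral
      rw [covariance_fun_div_left, covariance_fun_div_right, div_div, hsq,
        hA.covariance_setIntegral_smul hD hL ht, mul_div_mul_left _ _ (pow_pos ht d).ne']
    rw [hcov, hkey t ht, mul_div_assoc, ← integral_div]
    simp only [← mul_div_assoc, integral_div]

/-- The first three conjuncts say that all expressions in the limit relation, which is the last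
conjunct, are well defined: the covariances, the directional derivatives, and the integrals. -/
theorem theorem1p1 {d : ℕ} (hd : 1 ≤ d)
    {Ω : Type*} [MeasurableSpace Ω] (P : Measure Ω) [IsProbabilityMeasure P]
    (A : Eucl d → Ω → ℝ) (K : Eucl d → ℝ) (hA : IsWeaklyStationaryField P A K)
    (𝒟 : Set (Set (Eucl d)))
    (hcase : (IsRadial K ∧ 𝒟 = compactFinitePerimeter d) ∨ (∃ x₀ : Eucl d, 𝒟 = concentricBalls x₀))
    (α : ℝ) (hα : -1 < α) (hα' : α ≤ d)
    (hw : RegularlyVarying (ballIntegral K) α) :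
    ∀ D ∈ 𝒟, ∀ L ∈ 𝒟,
      (∀ t > 0, MemLp (fun ω => ∫ x in t • D, A x ω) 2 P ∧
        MemLp (fun ω => ∫ x in t • L, A x ω) 2 P) ∧
      (∀ θ : Metric.sphere (0 : Eucl d) 1,
        (∀ᵐ l ∂(volume.restrict (Ioi (0 : ℝ))),
          DifferentiableAt ℝ (fun s : ℝ => crossCovariogram D L (s • (θ : Eucl d))) l) ∧
        IntegrableOn (fun l : ℝ => radialDeriv D L θ l) (Ioi 0) ∧
        IntegrableOn (fun l : ℝ => (-radialDeriv D L θ l) * l ^ α) (Ioi 0)) ∧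
      Integrable (fun θ : Metric.sphere (0 : Eucl d) 1 => radialIntegral D L α θ)
        (surfaceMeasure d) ∧
      Tendsto (fun t : ℝ => cov[normalizedIntegral A K D t, normalizedIntegral A K L t; P])
        atTop
        (𝓝 ((1 / sphereArea d) *
          ∫ θ : Metric.sphere (0 : Eucl d) 1, radialIntegral D L α θ ∂(surfaceMeasure d))) := by
  -- In the first conjunct the scalar `t` is a natural number, acting by iterated Minkowski sums.
  intro D hD L hL
  obtain ⟨hDc, hLc, -⟩ := exists_lipschitzWith_crossCovariogram_of_case hcase hD hL
  exact ⟨fun n _ => ⟨hA.memLp_setIntegral (hDc.nsmul_set n), hA.memLp_setIntegral (hLc.nsmul_set n)⟩,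
    (tendsto_covariance_normalizedIntegral hd P A K hA 𝒟 hcase α hα hα' hw D hD L hL).2⟩
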